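/- Let $n\ge 1$, let $\langle z,w\rangle=\sum_{i=1}^n z_i\overline{w_i}$ and $|z|=\langle z,z\rangle^{1/2}$ on $\mathbb{C}^n$, and let $\mathbb{B}=\{z\in\mathbb{C}^n:|z|<1\}$. For $a\in\mathbb{B}$ let $P_a$ be the orthogonal projection of $\mathbb{C}^n$ onto the complex span of $a$ (so $P_0=0$), $Q_a=I-P_a$, $s_a=\sqrt{1-|a|^2}$, and $$\Phi_a(z)=\frac{a-P_az-s_aQ_az}{1-\langle z,a\rangle},\qquad z\in\mathbb{B}.$$ Let $dV$ be Lebesgue measure on $\mathbb{B}$ normalized so that $V(\mathbb{B})=1$, let $d\lambda(z)=(1-|z|^2)^{-n-1}dV(z)$, and for $\alpha>-1$ let $$dV_\alpha(z)=\frac{\Gamma(n+\alpha+1)}{n!\,\Gamma(\alpha+1)}(1-|z|^2)^\alpha dV(z).$$ For $p\ge1$, $q,s>0$ let $\mathcal{N}(p,q,s)$ be the set of holomorphic $f:\mathbb{B}\to\mathbb{C}$ with $$\sup_{a\in\mathbb{B}}\int_{\mathbb{B}}|f(z)|^p(1-|z|^2)^q(1-|\Phi_a(z)|^2)^{ns}\,d\lambda(z)<\infty.$$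 **Theorem 3.2.** Let $f:\mathbb{B}\to\mathbb{C}$ be holomorphic and let $p,q,s,\alpha$ be real numbers with $q>0$, $s>\max\{0,1-\frac qn\}$, $\alpha>q+ns-n-1$ and $p\ge 2(n+1+\alpha)$ (these imply $\alpha>-1$ and $p>1$). Then $f\in\mathcal{N}(p,q,s)$ if and only if $$\sup_{a\in\mathbb{B}}\int_{\mathbb{B}}\int_{\mathbb{B}}\frac{|f(z)-f(w)|^p}{|w-P_wz-s_wQ_wz|^{2(n+1+\alpha)}}(1-|z|^2)^q(1-|\Phi_a(z)|^2)^{ns}\,dV_\alpha(w)\,dV_\alpha(z)<\infty.$$ Moreover, $|w-P_wz-s_wQ_wz|=|\Phi_z(w)|\,|1-\langle z,w\rangle|$ for all $z,w\in\mathbb{B}$, so the denominator may equivalently be written as $\big(|\Phi_z(w)|\,|1-\langle z,w\rangle|\big)^{2(n+1+\alpha)}$. -/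

import Mathlib

open MeasureTheory Metric
open scoped ENNReal

noncomputable section

/-- The Hermitian pairing `⟨z, w⟩ = ∑ z_i * conj w_i` on `ℂⁿ`, linear in the first variable
(Mathlib's `inner` is linear in the second one). -/
def herm {n : ℕ} (z w : EuclideanSpace ℂ (Fin n)) : ℂ := inner ℂ w z

/-- The open unit ball of `ℂⁿ`. -/
def unitBall (n : ℕ) : Set (EuclideanSpace ℂ (Fin n)) := ball 0 1

/-- The vector `a - P_a z - s_a Q_a z`, where `P_a` is the orthogonal projection onto the complex
span of `a`, `Q_a = I - P_a` and `s_a = √(1 - |a|²)`. For `a = 0` one has `P_0 = 0`, `Q_0 = I`,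
`s_0 = 1`, and the vector is `-z`. -/
def mobNum {n : ℕ} (a z : EuclideanSpace ℂ (Fin n)) : EuclideanSpace ℂ (Fin n) :=
  a - (Submodule.span ℂ {a}).starProjection z
    - ((Real.sqrt (1 - ‖a‖ ^ 2) : ℝ) : ℂ) • (z - (Submodule.span ℂ {a}).starProjection z)

/-- The involutive automorphism `Φ_a` of the unit ball interchanging `0` and `a`
(for `a = 0` this is `Φ_0 z = -z`). -/
def mobPhi {n : ℕ} (a z : EuclideanSpace ℂ (Fin n)) : EuclideanSpace ℂ (Fin n) :=
  (1 - herm z a)⁻¹ • mobNum a z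

/-- `dV`: Lebesgue measure on the unit ball, normalized to have total mass one. -/
def ballVol (n : ℕ) : Measure (EuclideanSpace ℂ (Fin n)) :=
  (volume (unitBall n))⁻¹ • volume.restrict (unitBall n)

/-- `dV_α = Γ(n+α+1) / (n! Γ(α+1)) * (1 - |z|²)^α dV`. -/
def ballVolW (n : ℕ) (α : ℝ) : Measure (EuclideanSpace ℂ (Fin n)) :=
  (ballVol n).withDensity fun z => ENNReal.ofReal
    (Real.Gamma (n + α + 1) / (n.factorial * Real.Gamma (α + 1)) * (1 - ‖z‖ ^ 2) ^ α)

/-- The Möbius invariant measure `dλ = (1 - |z|²)^(-n-1) dV`. -/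
def ballInv (n : ℕ) : Measure (EuclideanSpace ℂ (Fin n)) :=
  (ballVol n).withDensity fun z => ENNReal.ofReal ((1 - ‖z‖ ^ 2) ^ (-(n : ℝ) - 1))

/-- The space `𝒩(p,q,s)`: functions holomorphic on the unit ball (values off the ball play no role)
with `sup_a ∫ |f(z)|^p (1-|z|²)^q (1-|Φ_a(z)|²)^(ns) dλ(z) < ∞`. -/
def NSpace (n : ℕ) (p q s : ℝ) : Set (EuclideanSpace ℂ (Fin n) → ℂ) :=
  {f | DifferentiableOn ℂ f (unitBall n) ∧
    ⨆ a ∈ unitBall n, ∫⁻ z, ENNReal.ofReal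
      (‖f z‖ ^ p * (1 - ‖z‖ ^ 2) ^ q * (1 - ‖mobPhi a z‖ ^ 2) ^ (n * s)) ∂(ballInv n) < ∞}

end

/-! Write m = n+1+α, σ = ns and γ = q+σ-n-1; the hypotheses say γ > -1, q+σ < m and 2m ≤ p. Since
1-|Φ_a(z)|² = `jac a z` · `rho z`, the two suprema become, up to constants, those of ∫ `jac a`^σ
|f|^p and ∫ `jac a`^σ `oscInv f` against the weight (1-|z|²)^γ. The substitution w = Φ_z(u) turns
`oscInv f` at z into ∫ |f(Φ_z(u)) - f(z)|^p |u|^(-2m) (1-|u|²)^α du, so the oscillation is Möbius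
invariant.

From 𝒩 to the double integral: near u = 0 the Schwarz lemma gives a factor |u|^p, which absorbs
|u|^(-2m) because 2m ≤ p. Hence `oscInv f` is at most a Berezin-type transform of |f|^p
(`exists_oscInt_le`). Fubini and the two-point Forelli-Rudin estimate
`exists_lintegral_bker_mul_bker_le` show that this transform respects the weights |1-⟨z,a⟩|^(-2σ);
this is where q+σ < m enters.

Conversely, the invariant sub-mean value property bounds increments of f over invariant distance 1/2
by averages of `oscInv f`. Chaining dyadically along the radius from z to 0, with geometric decay,
gives a pointwise bound of |f(z)-f(0)|^p by a kernel operator applied to `oscInv f`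
(`exists_norm_sub_zero_rpow_le`). That operator need not be bounded for the weight |1-⟨z,a⟩|^(-2σ),
as 2σ may be too large. The weight is therefore replaced by the larger (1-|a|²)^t |1-⟨z,a⟩|^(-(t+σ))
with small t; `exists_lintegral_carleson_le` shows that both weights give comparable suprema over a.
-/

noncomputable section

variable {n : ℕ}

/-! ### The kernel |1 - ⟨z, w⟩| on the ball -/

/-- The defining function `1 - |z|²` of the unit ball. -/
def rho (z : EuclideanSpace ℂ (Fin n)) : ℝ := 1 - ‖z‖ ^ 2

/-- The modulus `|1 - ⟨z, w⟩|`. -/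
def bker (z w : EuclideanSpace ℂ (Fin n)) : ℝ := ‖1 - herm z w‖

lemma mem_unitBall {z : EuclideanSpace ℂ (Fin n)} : z ∈ unitBall n ↔ ‖z‖ < 1 := by
  simp [unitBall]

lemma rho_pos {z : EuclideanSpace ℂ (Fin n)} (hz : z ∈ unitBall n) : 0 < rho z := by
  rw [mem_unitBall] at hz
  have := norm_nonneg z
  unfold rho; nlinarith

lemma rho_le_one (z : EuclideanSpace ℂ (Fin n)) : rho z ≤ 1 := by
  unfold rho; nlinarith [sq_nonneg ‖z‖]

lemma herm_conj (z w : EuclideanSpace ℂ (Fin n)) : (starRingEnd ℂ) (herm z w) = herm w z := by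
  simp [herm]

lemma herm_self (z : EuclideanSpace ℂ (Fin n)) : herm z z = (‖z‖ : ℂ) ^ 2 := by
  simp [herm, inner_self_eq_norm_sq_to_K]

lemma herm_sub_left (x y w : EuclideanSpace ℂ (Fin n)) : herm (x - y) w = herm x w - herm y w := by
  simp [herm]

lemma herm_smul_left (c : ℂ) (x w : EuclideanSpace ℂ (Fin n)) : herm (c • x) w = c * herm x w := by
  simp [herm]

lemma herm_sub_right (x y w : EuclideanSpace ℂ (Fin n)) : herm w (x - y) = herm w x - herm w y := by
  simp [herm]

lemma herm_smul_right (c : ℂ) (x w : EuclideanSpace ℂ (Fin n)) :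
    herm w (c • x) = (starRingEnd ℂ) c * herm w x := by
  simp [herm, mul_comm]

lemma norm_herm_le (z w : EuclideanSpace ℂ (Fin n)) : ‖herm z w‖ ≤ ‖z‖ * ‖w‖ := by
  rw [mul_comm]; exact norm_inner_le_norm w z

lemma bker_comm (z w : EuclideanSpace ℂ (Fin n)) : bker z w = bker w z := by
  unfold bker
  rw [← Complex.norm_conj, map_sub, herm_conj, map_one]

lemma one_sub_le_bker (z w : EuclideanSpace ℂ (Fin n)) : 1 - ‖z‖ * ‖w‖ ≤ bker z w := by
  have h1 := norm_sub_norm_le (1 : ℂ) (herm z w)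
  have h2 := norm_herm_le z w
  unfold bker
  rw [norm_one] at h1
  linarith

lemma bker_le (z w : EuclideanSpace ℂ (Fin n)) : bker z w ≤ 1 + ‖z‖ * ‖w‖ := by
  have h1 := norm_sub_le (1 : ℂ) (herm z w)
  have h2 := norm_herm_le z w
  unfold bker
  rw [norm_one] at h1
  linarith

lemma one_sub_norm_le_bker {z w : EuclideanSpace ℂ (Fin n)} (hz : z ∈ unitBall n) :
    1 - ‖w‖ ≤ bker z w := by
  rw [mem_unitBall] at hz
  have := one_sub_le_bker z w
  nlinarith [norm_nonneg w]

lemma bker_pos {z w : EuclideanSpace ℂ (Fin n)} (hz : z ∈ unitBall n) (hw : w ∈ unitBall n) :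
    0 < bker z w := by
  have := one_sub_norm_le_bker (w := w) hz
  rw [mem_unitBall] at hw
  linarith

lemma bker_lt_two {z w : EuclideanSpace ℂ (Fin n)} (hz : z ∈ unitBall n) (hw : w ∈ unitBall n) :
    bker z w < 2 := by
  have := bker_le z w
  rw [mem_unitBall] at hz hw
  nlinarith [norm_nonneg w, norm_nonneg z]

lemma rho_le_two_bker {z w : EuclideanSpace ℂ (Fin n)} (hz : z ∈ unitBall n)
    (hw : w ∈ unitBall n) : rho w ≤ 2 * bker z w := by
  have := one_sub_norm_le_bker (w := w) hz
  rw [mem_unitBall] at hw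
  unfold rho
  nlinarith [norm_nonneg w]

lemma one_sub_herm_ne {z w : EuclideanSpace ℂ (Fin n)} (hz : z ∈ unitBall n)
    (hw : w ∈ unitBall n) : 1 - herm z w ≠ 0 := by
  rw [← norm_pos_iff]; exact bker_pos hz hw

/-! ### Algebra of the automorphisms Φ_a -/

lemma sqrt_rho_sq {a : EuclideanSpace ℂ (Fin n)} (ha : a ∈ unitBall n) :
    ((Real.sqrt (rho a) : ℝ) : ℂ) ^ 2 = 1 - herm a a := by
  rw [herm_self, ← Complex.ofReal_pow, Real.sq_sqrt (rho_pos ha).le]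
  simp [rho]

lemma one_add_sqrt_ne (x : ℝ) : (1 + (Real.sqrt x : ℂ)) ≠ 0 := by
  have : (0:ℝ) < 1 + Real.sqrt x := by positivity
  exact_mod_cast this.ne'

/-- Since |a|² = (1-s_a)(1+s_a), the quotient (1-s_a)/|a|² is 1/(1+s_a). This removes the projection
and the division by |a|², so a = 0 needs no separate treatment afterwards. -/
lemma mobNum_eq {a : EuclideanSpace ℂ (Fin n)} (ha : a ∈ unitBall n)
    (z : EuclideanSpace ℂ (Fin n)) :
    mobNum a z = (1 - herm z a / (1 + (Real.sqrt (rho a) : ℂ))) • a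
      - (Real.sqrt (rho a) : ℂ) • z := by
  have hs := sqrt_rho_sq ha
  have h1 := one_add_sqrt_ne (rho a)
  unfold mobNum
  change a - _ - ((Real.sqrt (rho a) : ℝ) : ℂ) • _ = _
  set s : ℂ := ((Real.sqrt (rho a) : ℝ) : ℂ)
  rw [Submodule.starProjection_singleton]
  by_cases h0 : a = 0
  · simp [h0]
  have hA : ((‖a‖ : ℂ) ^ 2) ≠ 0 := by simpa using h0
  rw [herm_self] at hs
  change a - (herm z a / _) • a - _ • (z - (herm z a / _) • a) = _
  have hA' : ((RCLike.ofReal (‖a‖ ^ 2) : ℂ)) = (1 - s) * (1 + s) := by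
    have : ((RCLike.ofReal (‖a‖ ^ 2) : ℂ)) = (‖a‖ : ℂ) ^ 2 := by simp
    rw [this]; linear_combination hs
  have h2 : (1 - s) ≠ 0 := by
    intro h
    apply hA
    linear_combination h * (1 + s) + hs
  rw [hA']
  match_scalars <;> field_simp <;> ring

/-- The polarized identity behind every later formula for Φ_a: its diagonal gives the norm of the
numerator, its off-diagonal part the transformation rule of 1 - ⟨z, w⟩. -/
lemma norm_mobNum_sq_aux {a : EuclideanSpace ℂ (Fin n)} (ha : a ∈ unitBall n)
    (z w : EuclideanSpace ℂ (Fin n)) :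
    herm (mobNum a z) (mobNum a w)
      = (1 - herm z a) * (1 - herm a w) - (rho a : ℂ) * (1 - herm z w) := by
  have hs := sqrt_rho_sq ha
  have h1 := one_add_sqrt_ne (rho a)
  have hr : (rho a : ℂ) = ((Real.sqrt (rho a) : ℝ) : ℂ) ^ 2 := by
    rw [← Complex.ofReal_pow, Real.sq_sqrt (rho_pos ha).le]
  have hA : herm a a = 1 - ((Real.sqrt (rho a) : ℝ) : ℂ) ^ 2 := by rw [hs]; ring
  rw [mobNum_eq ha, mobNum_eq ha]
  simp only [herm_sub_left, herm_sub_right, herm_smul_left, herm_smul_right, map_sub, map_div₀,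
    map_one, map_add, Complex.conj_ofReal, herm_conj]
  rw [hA, hr]
  set s : ℂ := ((Real.sqrt (rho a) : ℝ) : ℂ)
  field_simp
  ring

lemma norm_mobNum_sq {a : EuclideanSpace ℂ (Fin n)} (ha : a ∈ unitBall n)
    (z : EuclideanSpace ℂ (Fin n)) :
    ‖mobNum a z‖ ^ 2 = bker z a ^ 2 - rho a * rho z := by
  have h := norm_mobNum_sq_aux ha z z
  rw [herm_self, herm_self, ← herm_conj z a] at h
  have h2 : (1 - herm z a) * (1 - (starRingEnd ℂ) (herm z a)) = ((bker z a ^ 2 : ℝ) : ℂ) := by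
    have := Complex.mul_conj (1 - herm z a)
    rw [map_sub, map_one] at this
    rw [this, Complex.normSq_eq_norm_sq]; rfl
  rw [h2] at h
  have : ((‖mobNum a z‖ ^ 2 : ℝ) : ℂ) = ((bker z a ^ 2 - rho a * rho z : ℝ) : ℂ) := by
    push_cast
    rw [h]; simp [rho]
  exact_mod_cast this

lemma norm_mobNum_comm {a z : EuclideanSpace ℂ (Fin n)} (ha : a ∈ unitBall n)
    (hz : z ∈ unitBall n) : ‖mobNum a z‖ = ‖mobNum z a‖ := by
  have h1 := norm_mobNum_sq ha z
  have h2 := norm_mobNum_sq hz a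
  rw [bker_comm, mul_comm, ← h2] at h1
  exact (pow_left_inj₀ (norm_nonneg _) (norm_nonneg _) two_ne_zero).1 h1

lemma norm_mobPhi (a z : EuclideanSpace ℂ (Fin n)) :
    ‖mobPhi a z‖ = ‖mobNum a z‖ / bker z a := by
  unfold mobPhi bker
  rw [norm_smul, norm_inv]; ring

lemma norm_mobNum_eq_mobPhi {z w : EuclideanSpace ℂ (Fin n)} (hz : z ∈ unitBall n)
    (hw : w ∈ unitBall n) : ‖mobNum w z‖ = ‖mobPhi z w‖ * bker z w := by
  rw [norm_mobPhi, norm_mobNum_comm hw hz, bker_comm z w, div_mul_cancel₀]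
  exact (bker_pos hw hz).ne'

lemma rho_mobPhi {a z : EuclideanSpace ℂ (Fin n)} (ha : a ∈ unitBall n) (hz : z ∈ unitBall n) :
    rho (mobPhi a z) = rho a * rho z / bker z a ^ 2 := by
  have := (bker_pos hz ha).ne'
  conv_lhs => unfold rho
  rw [norm_mobPhi, div_pow, norm_mobNum_sq ha]
  field_simp
  ring

lemma mobPhi_mem {a z : EuclideanSpace ℂ (Fin n)} (ha : a ∈ unitBall n) (hz : z ∈ unitBall n) :
    mobPhi a z ∈ unitBall n := by
  have h : 0 < rho (mobPhi a z) := by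
    rw [rho_mobPhi ha hz]
    have := rho_pos ha; have := rho_pos hz; have := bker_pos hz ha
    positivity
  rw [mem_unitBall]
  unfold rho at h
  nlinarith [norm_nonneg (mobPhi a z)]

lemma one_sub_herm_mobPhi {a z w : EuclideanSpace ℂ (Fin n)} (ha : a ∈ unitBall n)
    (hz : z ∈ unitBall n) (hw : w ∈ unitBall n) :
    1 - herm (mobPhi a z) (mobPhi a w)
      = rho a * (1 - herm z w) / ((1 - herm z a) * (1 - herm a w)) := by
  have h1 := one_sub_herm_ne hz ha
  have h2 := one_sub_herm_ne ha hw
  unfold mobPhi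
  rw [herm_smul_left, herm_smul_right, norm_mobNum_sq_aux ha, map_inv₀, map_sub, map_one, herm_conj]
  field_simp
  ring

lemma bker_mobPhi_mobPhi {a z w : EuclideanSpace ℂ (Fin n)} (ha : a ∈ unitBall n)
    (hz : z ∈ unitBall n) (hw : w ∈ unitBall n) :
    bker (mobPhi a z) (mobPhi a w) = rho a * bker z w / (bker z a * bker w a) := by
  unfold bker
  rw [one_sub_herm_mobPhi ha hz hw, norm_div, norm_mul, norm_mul, Complex.norm_real,
    Real.norm_of_nonneg (rho_pos ha).le]
  have := bker_comm a w
  unfold bker at this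
  rw [this]

lemma zero_mem_unitBall : (0 : EuclideanSpace ℂ (Fin n)) ∈ unitBall n := by simp [mem_unitBall]

lemma mobPhi_zero {a : EuclideanSpace ℂ (Fin n)} : mobPhi a 0 = a := by
  simp [mobPhi, mobNum, herm]

lemma one_sub_herm_mobPhi_left {a z : EuclideanSpace ℂ (Fin n)} (ha : a ∈ unitBall n)
    (hz : z ∈ unitBall n) : 1 - herm (mobPhi a z) a = rho a / (1 - herm z a) := by
  have := one_sub_herm_mobPhi ha hz zero_mem_unitBall
  rw [mobPhi_zero] at this
  rw [this]; simp [herm]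

lemma bker_zero_right (z : EuclideanSpace ℂ (Fin n)) : bker z 0 = 1 := by simp [bker, herm]

lemma bker_zero_left (z : EuclideanSpace ℂ (Fin n)) : bker 0 z = 1 := by simp [bker, herm]

lemma bker_mobPhi {a z : EuclideanSpace ℂ (Fin n)} (ha : a ∈ unitBall n)
    (hz : z ∈ unitBall n) : bker (mobPhi a z) a = rho a / bker z a := by
  have := bker_mobPhi_mobPhi ha hz zero_mem_unitBall
  rw [mobPhi_zero] at this
  rw [this]; simp [bker_zero_right, bker_zero_left]

lemma mobPhi_mobPhi {a z : EuclideanSpace ℂ (Fin n)} (ha : a ∈ unitBall n)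
    (hz : z ∈ unitBall n) : mobPhi a (mobPhi a z) = z := by
  have hs := sqrt_rho_sq ha
  have h1 := one_add_sqrt_ne (rho a)
  have hr : (rho a : ℂ) = ((Real.sqrt (rho a) : ℝ) : ℂ) ^ 2 := by
    rw [← Complex.ofReal_pow, Real.sq_sqrt (rho_pos ha).le]
  have hr0 : (rho a : ℂ) ≠ 0 := by exact_mod_cast (rho_pos ha).ne'
  have hd := one_sub_herm_ne hz ha
  have hx := one_sub_herm_mobPhi_left ha hz
  have hx' : herm (mobPhi a z) a = 1 - rho a / (1 - herm z a) := by rw [← hx]; ring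
  rw [mobPhi, hx, mobNum_eq ha, hx', mobPhi, mobNum_eq ha]
  rw [hr] at hr0 ⊢
  set s : ℂ := ((Real.sqrt (rho a) : ℝ) : ℂ)
  have hs0 : s ≠ 0 := by
    intro h; simp [h] at hr0
  match_scalars <;> field_simp <;> ring

lemma mobPhi_image {a : EuclideanSpace ℂ (Fin n)} (ha : a ∈ unitBall n) :
    mobPhi a '' unitBall n = unitBall n := by
  ext z
  constructor
  · rintro ⟨w, hw, rfl⟩; exact mobPhi_mem ha hw
  · intro hz; exact ⟨mobPhi a z, mobPhi_mem ha hz, mobPhi_mobPhi ha hz⟩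

lemma mobPhi_injOn {a : EuclideanSpace ℂ (Fin n)} (ha : a ∈ unitBall n) :
    Set.InjOn (mobPhi a) (unitBall n) := by
  intro x hx y hy h
  rw [← mobPhi_mobPhi ha hx, h, mobPhi_mobPhi ha hy]

lemma measurableSet_unitBall : MeasurableSet (unitBall n) := measurableSet_ball

/-! ### Jacobian of Φ_a and change of variables -/

/-- The complex derivative of `Φ_a` at `z`. -/
def mobDeriv (a z : EuclideanSpace ℂ (Fin n)) :
    EuclideanSpace ℂ (Fin n) →L[ℂ] EuclideanSpace ℂ (Fin n) :=
  (-((Real.sqrt (rho a) : ℂ) / (1 - herm z a))) • (ContinuousLinearMap.id ℂ _ +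
    (innerSL ℂ a).smulRight (((Real.sqrt (rho a) : ℂ) * (1 + (Real.sqrt (rho a) : ℂ)))⁻¹ • a
      - ((Real.sqrt (rho a) : ℂ) * (1 - herm z a))⁻¹ • mobNum a z))

lemma sqrt_rho_ne {a : EuclideanSpace ℂ (Fin n)} (ha : a ∈ unitBall n) :
    (Real.sqrt (rho a) : ℂ) ≠ 0 := by
  exact_mod_cast (Real.sqrt_pos.2 (rho_pos ha)).ne'

lemma hasFDerivAt_mobPhi {a z : EuclideanSpace ℂ (Fin n)} (ha : a ∈ unitBall n)
    (hz : z ∈ unitBall n) : HasFDerivAt (mobPhi a) (mobDeriv a z) z := by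
  have hd := one_sub_herm_ne hz ha
  have hs0 := sqrt_rho_ne ha
  have h1 := one_add_sqrt_ne (rho a)
  have hh : HasFDerivAt (fun w : EuclideanSpace ℂ (Fin n) => herm w a) (innerSL ℂ a) z :=
    (innerSL ℂ a).hasFDerivAt
  have e : mobPhi a = fun w => (1 - herm w a)⁻¹ • ((1 - herm w a / (1 + (Real.sqrt (rho a) : ℂ))) • a
      - (Real.sqrt (rho a) : ℂ) • w) := by
    ext1 w; rw [mobPhi, mobNum_eq ha]
  rw [e]
  have hinv := (hasDerivAt_inv hd).comp_hasFDerivAt z (hh.const_sub 1)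
  have hnum := (((hh.mul_const (1 + (Real.sqrt (rho a) : ℂ))⁻¹).const_sub 1).smul_const a).sub
    ((hasFDerivAt_id z).const_smul (Real.sqrt (rho a) : ℂ))
  have := hinv.smul hnum
  refine this.congr_fderiv ?_
  ext1 h
  rw [mobDeriv, mobNum_eq ha]
  change (1 - herm z a)⁻¹ • ((-((1 + (Real.sqrt (rho a) : ℂ))⁻¹ • innerSL ℂ a h)) • a - (Real.sqrt (rho a) : ℂ) • h)
    + (-((1 - herm z a) ^ 2)⁻¹ • -(innerSL ℂ a h)) • ((1 - herm z a * (1 + (Real.sqrt (rho a) : ℂ))⁻¹) • a - (Real.sqrt (rho a) : ℂ) • z) =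
    (-((Real.sqrt (rho a) : ℂ) / (1 - herm z a))) • (h + innerSL ℂ a h • (_ - _ • (_ - _)))
  set s : ℂ := (Real.sqrt (rho a) : ℂ)
  set x := innerSL ℂ a h
  match_scalars <;> (try simp only [smul_eq_mul]) <;> field_simp <;> ring

/-- The derivative is a scalar times a rank-one perturbation of the identity, so its complex
determinant is explicit; the real determinant is the squared modulus of the complex one. -/
lemma det_mobDeriv {a z : EuclideanSpace ℂ (Fin n)} (ha : a ∈ unitBall n)
    (hz : z ∈ unitBall n) :
    |((mobDeriv a z).restrictScalars ℝ).det| = (rho a / bker z a ^ 2) ^ (n + 1) := by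
  have hd := one_sub_herm_ne hz ha
  have hs0 := sqrt_rho_ne ha
  have h1 := one_add_sqrt_ne (rho a)
  have hA := sqrt_rho_sq ha
  have hC : LinearMap.det ((mobDeriv a z : EuclideanSpace ℂ (Fin n) →L[ℂ] EuclideanSpace ℂ (Fin n)) :
      EuclideanSpace ℂ (Fin n) →ₗ[ℂ] EuclideanSpace ℂ (Fin n))
      = (-((Real.sqrt (rho a) : ℂ) / (1 - herm z a))) ^ n *
        ((Real.sqrt (rho a) : ℂ) / (1 - herm z a)) := by
    have : ((mobDeriv a z : EuclideanSpace ℂ (Fin n) →L[ℂ] EuclideanSpace ℂ (Fin n)) :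
      EuclideanSpace ℂ (Fin n) →ₗ[ℂ] EuclideanSpace ℂ (Fin n)) =
      (-((Real.sqrt (rho a) : ℂ) / (1 - herm z a))) • LinearMap.transvection
        ((innerSL ℂ a : EuclideanSpace ℂ (Fin n) →L[ℂ] ℂ) : EuclideanSpace ℂ (Fin n) →ₗ[ℂ] ℂ)
        (((Real.sqrt (rho a) : ℂ) * (1 + (Real.sqrt (rho a) : ℂ)))⁻¹ • a
          - ((Real.sqrt (rho a) : ℂ) * (1 - herm z a))⁻¹ • mobNum a z) := by
      ext1 h
      rfl
    rw [this, LinearMap.det_smul, LinearMap.transvection.det]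
    simp only [finrank_euclideanSpace, Fintype.card_fin]
    congr 1
    change 1 + herm _ a = _
    rw [herm_sub_left, herm_smul_left, herm_smul_left, mobNum_eq ha, herm_sub_left,
      herm_smul_left, herm_smul_left]
    have : herm a a = 1 - (Real.sqrt (rho a) : ℂ) ^ 2 := by rw [hA]; ring
    rw [this]
    field_simp
    ring
  rw [ContinuousLinearMap.det]
  have : ((((mobDeriv a z).restrictScalars ℝ :
      EuclideanSpace ℂ (Fin n) →L[ℝ] EuclideanSpace ℂ (Fin n))) :
      EuclideanSpace ℂ (Fin n) →ₗ[ℝ] EuclideanSpace ℂ (Fin n)) =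
      ((mobDeriv a z : EuclideanSpace ℂ (Fin n) →L[ℂ] EuclideanSpace ℂ (Fin n)) :
      EuclideanSpace ℂ (Fin n) →ₗ[ℂ] EuclideanSpace ℂ (Fin n)).restrictScalars ℝ := rfl
  rw [this, LinearMap.det_restrictScalars, hC, Algebra.norm_complex_eq]
  change |Complex.normSq _| = _
  rw [Complex.normSq_eq_norm_sq]
  rw [abs_of_nonneg (by positivity), norm_mul, norm_pow, norm_neg, norm_div, Complex.norm_real,
    Real.norm_of_nonneg (Real.sqrt_nonneg _), ← pow_succ, ← pow_mul, mul_comm, pow_mul, div_pow,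
    Real.sq_sqrt (rho_pos ha).le]
  rfl

lemma lintegral_mobPhi {a : EuclideanSpace ℂ (Fin n)} (ha : a ∈ unitBall n)
    (F : EuclideanSpace ℂ (Fin n) → ℝ≥0∞) :
    ∫⁻ z in unitBall n, F z =
      ∫⁻ z in unitBall n, ENNReal.ofReal ((rho a / bker z a ^ 2) ^ (n + 1)) * F (mobPhi a z) := by
  have := lintegral_image_eq_lintegral_abs_det_fderiv_mul volume (measurableSet_unitBall (n := n))
    (f' := fun z => (mobDeriv a z).restrictScalars ℝ)
    (fun z hz => ((hasFDerivAt_mobPhi ha hz).restrictScalars ℝ).hasFDerivWithinAt)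
    (mobPhi_injOn ha) F
  rw [mobPhi_image ha] at this
  rw [this]
  refine setLIntegral_congr_fun measurableSet_unitBall fun z hz => ?_
  simp only [det_mobDeriv ha hz]

/-! ### Weighted measures (1 - |z|²)^δ dz -/

lemma measurable_rho : Measurable (rho (n := n)) := by unfold rho; fun_prop

lemma continuous_bker : Continuous fun x : EuclideanSpace ℂ (Fin n) × EuclideanSpace ℂ (Fin n) =>
    bker x.1 x.2 := by
  unfold bker herm; fun_prop

lemma measurable_bker_left (w : EuclideanSpace ℂ (Fin n)) : Measurable fun z => bker z w := by
  have : Continuous fun z => bker z w := by unfold bker herm; fun_prop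
  exact this.measurable

lemma measurable_ofReal_rho_rpow (δ : ℝ) :
    Measurable fun z : EuclideanSpace ℂ (Fin n) => ENNReal.ofReal (rho z ^ δ) :=
  (measurable_rho.pow_const δ).ennreal_ofReal

/-- The weighted measure `(1 - |z|²) ^ δ dz` on the unit ball. -/
def bw (n : ℕ) (δ : ℝ) : Measure (EuclideanSpace ℂ (Fin n)) :=
  (volume.restrict (unitBall n)).withDensity fun z => ENNReal.ofReal (rho z ^ δ)

lemma lintegral_bw (δ : ℝ) (F : EuclideanSpace ℂ (Fin n) → ℝ≥0∞) :
    ∫⁻ z, F z ∂(bw n δ) = ∫⁻ z in unitBall n, ENNReal.ofReal (rho z ^ δ) * F z := by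
  unfold bw
  -- Only a finite density is needed here, so `F` may later be an integral whose measurability is
  -- not at hand.
  rw [lintegral_withDensity_eq_lintegral_mul_non_measurable _ (measurable_ofReal_rho_rpow δ)]
  · rfl
  · exact Filter.Eventually.of_forall fun _ => ENNReal.ofReal_lt_top

lemma ae_bw (δ : ℝ) : ∀ᵐ z ∂(bw n δ), z ∈ unitBall n :=
  (withDensity_absolutelyContinuous _ _).ae_le (ae_restrict_mem measurableSet_unitBall)

lemma lintegral_bw_mono {δ : ℝ} {F G : EuclideanSpace ℂ (Fin n) → ℝ≥0∞}
    (h : ∀ z ∈ unitBall n, F z ≤ G z) : ∫⁻ z, F z ∂(bw n δ) ≤ ∫⁻ z, G z ∂(bw n δ) :=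
  lintegral_mono_ae ((ae_bw δ).mono h)

lemma lintegral_bw_congr {δ : ℝ} {F G : EuclideanSpace ℂ (Fin n) → ℝ≥0∞}
    (h : ∀ z ∈ unitBall n, F z = G z) : ∫⁻ z, F z ∂(bw n δ) = ∫⁻ z, G z ∂(bw n δ) :=
  lintegral_congr_ae ((ae_bw δ).mono h)

lemma lintegral_bw_add (δ η : ℝ) (F : EuclideanSpace ℂ (Fin n) → ℝ≥0∞) :
    ∫⁻ z, F z ∂(bw n (δ + η)) = ∫⁻ z, ENNReal.ofReal (rho z ^ η) * F z ∂(bw n δ) := by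
  rw [lintegral_bw, lintegral_bw]
  refine setLIntegral_congr_fun measurableSet_unitBall fun z hz => ?_
  have := rho_pos hz
  rw [← mul_assoc, ← ENNReal.ofReal_mul (by positivity), Real.rpow_add this]

instance (δ : ℝ) : SFinite (bw n δ) := by unfold bw; infer_instance

/-- Change of variables under the automorphism `Φ_a` in weighted measures. -/
lemma lintegral_bw_mobPhi (δ : ℝ) {a : EuclideanSpace ℂ (Fin n)} (ha : a ∈ unitBall n)
    (F : EuclideanSpace ℂ (Fin n) → ℝ≥0∞) :
    ∫⁻ z, F z ∂(bw n δ) =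
      ∫⁻ z, ENNReal.ofReal ((rho a / bker z a ^ 2) ^ (δ + n + 1)) * F (mobPhi a z) ∂(bw n δ) := by
  rw [lintegral_bw, lintegral_bw, lintegral_mobPhi ha]
  refine setLIntegral_congr_fun measurableSet_unitBall fun z hz => ?_
  have h1 := rho_pos hz
  have h2 := rho_pos ha
  have h3 := bker_pos hz ha
  rw [← mul_assoc, ← mul_assoc, ← ENNReal.ofReal_mul (by positivity),
    ← ENNReal.ofReal_mul (by positivity), rho_mobPhi ha hz]
  congr 2
  have : rho a * rho z / bker z a ^ 2 = rho a / bker z a ^ 2 * rho z := by ring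
  rw [this, Real.mul_rpow (by positivity) (by positivity), add_assoc, Real.rpow_add (by positivity)]
  have : ((n : ℝ) + 1) = ((n + 1 : ℕ) : ℝ) := by push_cast; ring
  rw [this, Real.rpow_natCast]
  ring

/-- In polar coordinates (1-y²)^δ = (1+y)^δ (1-y)^δ with a bounded first factor, leaving the
integrable singularity (1-y)^δ. -/
lemma bw_univ_lt_top (hn : 1 ≤ n) {δ : ℝ} (hδ : -1 < δ) : bw n δ Set.univ < ∞ := by
  have : Nonempty (Fin n) := ⟨⟨0, hn⟩⟩
  have key : IntegrableOn (fun z : EuclideanSpace ℂ (Fin n) => (1 - ‖z‖ ^ 2) ^ δ) (ball 0 1) := by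
    rw [integrableOn_fun_norm_addHaar volume (f := fun y => (1 - y ^ 2) ^ δ)]
    set k := Module.finrank ℝ (EuclideanSpace ℂ (Fin n)) - 1
    have h0 : IntegrableOn (fun y : ℝ => (1 - y) ^ δ) (Set.Ioo 0 1) := by
      have := (intervalIntegral.intervalIntegrable_rpow' (a := 1) (b := 0) hδ).comp_sub_left 1
      simp only [sub_self, sub_zero] at this
      exact ((intervalIntegrable_iff_integrableOn_Ioo_of_le zero_le_one).1 this)
    have h1 : ∀ y ∈ Set.Ioo (0:ℝ) 1, y ^ k • (1 - y ^ 2) ^ δ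
        = (y ^ k * (1 + y) ^ δ) * (1 - y) ^ δ := by
      intro y hy
      have : 1 - y ^ 2 = (1 + y) * (1 - y) := by ring
      rw [this, Real.mul_rpow (by linarith [hy.1]) (by linarith [hy.2]), smul_eq_mul]
      ring
    rw [integrableOn_congr_fun h1 measurableSet_Ioo]
    refine h0.bdd_mul (c := 2 ^ |δ|) (by fun_prop) ?_
    refine (ae_restrict_mem measurableSet_Ioo).mono fun y hy => ?_
    have p1 : (0:ℝ) ≤ 1 + y := by linarith [hy.1]
    rw [Real.norm_of_nonneg (by have := hy.1; positivity)]
    have a1 : y ^ k ≤ 1 := pow_le_one₀ hy.1.le hy.2.le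
    have a2 : (1 + y) ^ δ ≤ 2 ^ |δ| := by
      calc (1 + y) ^ δ ≤ (1 + y) ^ |δ| :=
            Real.rpow_le_rpow_of_exponent_le (by linarith [hy.1]) (le_abs_self δ)
        _ ≤ 2 ^ |δ| := Real.rpow_le_rpow p1 (by linarith [hy.2]) (abs_nonneg δ)
    calc _ ≤ 1 * (2:ℝ) ^ |δ| := mul_le_mul a1 a2 (by positivity) zero_le_one
      _ = _ := one_mul _
  have h := lintegral_bw (n := n) δ 1
  simp only [Pi.one_apply, lintegral_one, mul_one] at h
  rw [h]
  exact key.lintegral_lt_top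

instance neZero_bw [NeZero n] (δ : ℝ) : NeZero (bw n δ) := by
  refine ⟨fun h => ?_⟩
  have := lintegral_bw (n := n) δ 1
  rw [h, lintegral_zero_measure] at this
  have h2 := (lintegral_eq_zero_iff (μ := volume.restrict (unitBall n))
    (f := fun z => ENNReal.ofReal (rho z ^ δ)) (measurable_ofReal_rho_rpow δ)).1 (by simpa using this.symm)
  have h3 : ∀ᵐ z ∂(volume.restrict (unitBall n)), False := by
    filter_upwards [h2, ae_restrict_mem measurableSet_unitBall] with z hz hzB
    have := Real.rpow_pos_of_pos (rho_pos hzB) δ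
    simp at hz
    linarith
  simp at h3
  have := measure_ball_pos volume (0 : EuclideanSpace ℂ (Fin n)) one_pos
  exact this.ne' h3

/-! ### One-point kernel estimates by dyadic scales -/

/-- The point `(1 - τ) a` on the segment from `a` to the origin. -/
def shrink (τ : ℝ) (a : EuclideanSpace ℂ (Fin n)) : EuclideanSpace ℂ (Fin n) :=
  ((1 - τ : ℝ) : ℂ) • a

lemma norm_shrink {τ : ℝ} (h1 : τ ≤ 1) (a : EuclideanSpace ℂ (Fin n)) :
    ‖shrink τ a‖ = (1 - τ) * ‖a‖ := by
  rw [shrink, norm_smul, Complex.norm_real, Real.norm_of_nonneg (by linarith)]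

lemma shrink_mem {τ : ℝ} (h0 : 0 ≤ τ) (h1 : τ ≤ 1) {a : EuclideanSpace ℂ (Fin n)}
    (ha : a ∈ unitBall n) : shrink τ a ∈ unitBall n := by
  rw [mem_unitBall] at *
  rw [norm_shrink h1]
  nlinarith [norm_nonneg a]

lemma le_rho_shrink {τ : ℝ} (h0 : 0 ≤ τ) (h1 : τ ≤ 1) {a : EuclideanSpace ℂ (Fin n)}
    (ha : a ∈ unitBall n) : τ ≤ rho (shrink τ a) := by
  rw [mem_unitBall] at *
  rw [rho, norm_shrink h1]
  have : (1 - τ) * ‖a‖ ≤ 1 - τ := by nlinarith [norm_nonneg a]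
  have h2 : 0 ≤ (1 - τ) * ‖a‖ := mul_nonneg (by linarith) (norm_nonneg a)
  nlinarith

lemma herm_shrink (τ : ℝ) (w a : EuclideanSpace ℂ (Fin n)) :
    herm w (shrink τ a) = (1 - τ) * herm w a := by
  rw [shrink, herm_smul_right, Complex.conj_ofReal]; push_cast; rfl

lemma abs_bker_shrink_sub_le {τ : ℝ} (h0 : 0 ≤ τ) {w a : EuclideanSpace ℂ (Fin n)}
    (hw : w ∈ unitBall n) (ha : a ∈ unitBall n) :
    |bker w (shrink τ a) - bker w a| ≤ τ := by
  unfold bker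
  refine (abs_norm_sub_norm_le _ _).trans ?_
  rw [herm_shrink]
  have : (1 - (1 - (τ : ℂ)) * herm w a) - (1 - herm w a) = τ * herm w a := by ring
  rw [this, norm_mul, Complex.norm_real, Real.norm_of_nonneg h0]
  have := norm_herm_le w a
  rw [mem_unitBall] at *
  have h2 : ‖w‖ * ‖a‖ ≤ 1 := by nlinarith [norm_nonneg a, norm_nonneg w]
  nlinarith

lemma le_bker_shrink {τ : ℝ} (h1 : τ ≤ 1) {w a : EuclideanSpace ℂ (Fin n)}
    (hw : w ∈ unitBall n) (ha : a ∈ unitBall n) : τ ≤ bker w (shrink τ a) := by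
  have := one_sub_norm_le_bker (w := shrink τ a) hw
  rw [norm_shrink h1] at this
  rw [mem_unitBall] at ha
  nlinarith [norm_nonneg a]

/-- The real Jacobian factor `(1 - |a|²) / |1 - ⟨w, a⟩|²` of `Φ_a` at `w`. -/
def jac (a w : EuclideanSpace ℂ (Fin n)) : ℝ := rho a / bker w a ^ 2

lemma jac_pos {a w : EuclideanSpace ℂ (Fin n)} (ha : a ∈ unitBall n) (hw : w ∈ unitBall n) :
    0 < jac a w := by
  have := rho_pos ha; have := bker_pos hw ha
  unfold jac; positivity

lemma measurable_jac (a : EuclideanSpace ℂ (Fin n)) : Measurable (jac a) := by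
  unfold jac
  exact measurable_const.div ((measurable_bker_left a).pow_const 2)

/-- Retracting a to depth τ comparable to k = |1-⟨w,a⟩| makes 1-|·|² at least τ ≥ k/2 and the kernel
at most 3k, so the Jacobian there is at least 1/(18k). A power of the kernel is thus dominated by a
power of a Jacobian, whose integral is known. -/
lemma bker_rpow_neg_le {τ σ : ℝ} (hσ : 0 ≤ σ) (h1 : τ ≤ 1) {w a : EuclideanSpace ℂ (Fin n)}
    (hw : w ∈ unitBall n) (ha : a ∈ unitBall n) (hl : bker w a / 2 ≤ τ) (hu : τ ≤ 2 * bker w a) :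
    bker w a ^ (-σ) ≤ 18 ^ σ * jac (shrink τ a) w ^ σ := by
  have hk := bker_pos hw ha
  have h0 : 0 < τ := by linarith
  have hm := shrink_mem h0.le h1 ha
  have hk' := bker_pos hw hm
  have a1 := le_rho_shrink h0.le h1 ha
  have a2 := (abs_le.1 (abs_bker_shrink_sub_le h0.le hw ha)).2
  have a3 : bker w (shrink τ a) ≤ 3 * bker w a := by linarith
  have hj := jac_pos hm hw
  rw [Real.rpow_neg hk.le, ← Real.inv_rpow hk.le, ← Real.mul_rpow (by norm_num) hj.le]
  refine Real.rpow_le_rpow (by positivity) ?_ hσ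
  unfold jac
  rw [← mul_div_assoc, le_div_iff₀ (by positivity)]
  have a4 : bker w (shrink τ a) ^ 2 ≤ 9 * bker w a ^ 2 := by nlinarith
  calc (bker w a)⁻¹ * bker w (shrink τ a) ^ 2 ≤ (bker w a)⁻¹ * (9 * bker w a ^ 2) := by gcongr
    _ = 9 * bker w a := by field_simp
    _ ≤ 18 * rho (shrink τ a) := by linarith

lemma lintegral_jac {δ : ℝ} {a : EuclideanSpace ℂ (Fin n)} (ha : a ∈ unitBall n) :
    ∫⁻ w, ENNReal.ofReal (jac a w ^ (δ + n + 1)) ∂(bw n δ) = bw n δ Set.univ := by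
  have := lintegral_bw_mobPhi δ ha 1
  simp only [Pi.one_apply, lintegral_one, mul_one] at this
  exact this.symm

lemma measurable_ofReal_jac (a : EuclideanSpace ℂ (Fin n)) (σ : ℝ) :
    Measurable fun w => ENNReal.ofReal (jac a w ^ σ) :=
  ((measurable_jac a).pow_const σ).ennreal_ofReal

lemma tsum_ofReal_pow_lt_top {c : ℝ} (h0 : 0 ≤ c) (h1 : c < 1) :
    ∑' j : ℕ, ENNReal.ofReal (c ^ j) < ∞ := by
  rw [← ENNReal.ofReal_tsum_of_nonneg (fun j => by positivity)
    (summable_geometric_of_lt_one h0 h1)]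
  exact ENNReal.ofReal_lt_top

lemma half_rpow_lt_one {ε : ℝ} (hε : 0 < ε) : ((1 / 2 : ℝ) ^ ε) < 1 :=
  Real.rpow_lt_one (by norm_num) (by norm_num) hε

/-- On the shell where the kernel has size about 2^(-j), its critical power -(δ+n+1) is bounded by a
Jacobian power of integral `bw n δ Set.univ`. The gap ε = δ+n+1-c makes the sum over j geometric. -/
theorem exists_lintegral_bker_le (hn : 1 ≤ n) {δ c : ℝ} (hδ : -1 < δ)
    (hc1 : c < δ + n + 1) : ∃ C : ℝ≥0∞, C < ∞ ∧ ∀ b ∈ unitBall n,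
      ∫⁻ u, ENNReal.ofReal (bker u b ^ (-c)) ∂(bw n δ) ≤ C := by
  set σ := δ + n + 1 with hσ
  have hσ0 : 0 ≤ σ := by
    have : (0:ℝ) ≤ n := by positivity
    linarith
  set ε := σ - c with hε
  have hε0 : 0 < ε := by linarith
  refine ⟨ENNReal.ofReal (2 ^ ε * 18 ^ σ) * bw n δ Set.univ *
    ∑' j : ℕ, ENNReal.ofReal (((1 / 2 : ℝ) ^ ε) ^ j), ?_, fun b hb => ?_⟩
  · exact ENNReal.mul_lt_top (ENNReal.mul_lt_top ENNReal.ofReal_lt_top (bw_univ_lt_top hn hδ))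
      (tsum_ofReal_pow_lt_top (by positivity) (half_rpow_lt_one hε0))
  calc ∫⁻ u, ENNReal.ofReal (bker u b ^ (-c)) ∂(bw n δ)
      ≤ ∫⁻ u, ∑' j : ℕ, ENNReal.ofReal (2 ^ ε * 18 ^ σ * ((1 / 2 : ℝ) ^ ε) ^ j) *
          ENNReal.ofReal (jac (shrink ((1 / 2) ^ j) b) u ^ σ) ∂(bw n δ) := by
        refine lintegral_bw_mono fun u hu => ?_
        have hk := bker_pos hu hb
        -- The kernel is below 2, so half of it lies in (0, 1]; the chosen scale 2^(-j) is then
        -- between half the kernel and the kernel.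
        obtain ⟨j, hj1, hj2⟩ := exists_nat_pow_near_of_lt_one (x := bker u b / 2)
          (y := (1 / 2 : ℝ)) (by positivity) (by linarith [bker_lt_two hu hb]) (by norm_num)
          (by norm_num)
        refine le_trans ?_ (ENNReal.le_tsum j)
        rw [← ENNReal.ofReal_mul (by positivity)]
        refine ENNReal.ofReal_le_ofReal ?_
        have h := bker_rpow_neg_le hσ0 (pow_le_one₀ (by norm_num) (by norm_num) (n := j)) hu hb hj2
          (by rw [pow_succ] at hj1; linarith)
        have e1 : bker u b ^ (-c) = bker u b ^ ε * bker u b ^ (-σ) := by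
          rw [← Real.rpow_add hk]; congr 1; rw [hε]; ring
        have e2 : bker u b ^ ε ≤ 2 ^ ε * ((1 / 2 : ℝ) ^ ε) ^ j := by
          rw [← Real.rpow_natCast, ← Real.rpow_mul (by norm_num), mul_comm ε,
            Real.rpow_mul (by norm_num), Real.rpow_natCast, ← Real.mul_rpow (by norm_num)
            (by positivity)]
          exact Real.rpow_le_rpow hk.le (by linarith) hε0.le
        rw [e1]
        calc _ ≤ (2 ^ ε * ((1 / 2 : ℝ) ^ ε) ^ j) *
              (18 ^ σ * jac (shrink ((1 / 2) ^ j) b) u ^ σ) :=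
              mul_le_mul e2 h (by positivity) (by positivity)
          _ = _ := by ring
    _ = ∑' j : ℕ, ENNReal.ofReal (2 ^ ε * 18 ^ σ * ((1 / 2 : ℝ) ^ ε) ^ j) * bw n δ Set.univ := by
        rw [lintegral_tsum fun j => ((measurable_ofReal_jac _ _).const_mul _).aemeasurable]
        congr 1; ext j
        rw [lintegral_const_mul _ (measurable_ofReal_jac _ _), lintegral_jac
          (shrink_mem (by positivity) (pow_le_one₀ (by norm_num) (by norm_num)) hb)]
    _ = _ := by
        rw [← ENNReal.tsum_mul_left]
        congr 1; ext j
        rw [ENNReal.ofReal_mul (by positivity)]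
        ring

/-- Comparison of two scales of test kernels for Carleson type suprema. -/
theorem exists_lintegral_carleson_le {σ t : ℝ} (hσ : 0 ≤ σ) (ht : 0 < t) :
    ∃ C : ℝ≥0∞, C < ∞ ∧ ∀ (ν : Measure (EuclideanSpace ℂ (Fin n))) (M : ℝ≥0∞),
      (∀ᵐ w ∂ν, w ∈ unitBall n) →
      (∀ a ∈ unitBall n, ∫⁻ w, ENNReal.ofReal (jac a w ^ σ) ∂ν ≤ M) →
      ∀ a ∈ unitBall n, ∫⁻ w, ENNReal.ofReal (rho a ^ t * bker w a ^ (-(t + σ))) ∂ν ≤ C * M := by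
  refine ⟨ENNReal.ofReal (2 ^ t * 18 ^ σ) * ∑' j : ℕ, ENNReal.ofReal (((1 / 2 : ℝ) ^ t) ^ j),
    ENNReal.mul_lt_top ENNReal.ofReal_lt_top
      (tsum_ofReal_pow_lt_top (by positivity) (half_rpow_lt_one ht)), fun ν M hν hM a ha => ?_⟩
  have hh : 0 < 1 - ‖a‖ := by rw [mem_unitBall] at ha; linarith
  have hτ0 : ∀ j : ℕ, 0 ≤ min 1 (2 ^ j * (1 - ‖a‖)) := fun j => by positivity
  calc ∫⁻ w, ENNReal.ofReal (rho a ^ t * bker w a ^ (-(t + σ))) ∂ν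
      ≤ ∫⁻ w, ∑' j : ℕ, ENNReal.ofReal (2 ^ t * 18 ^ σ * ((1 / 2 : ℝ) ^ t) ^ j) *
          ENNReal.ofReal (jac (shrink (min 1 (2 ^ j * (1 - ‖a‖))) a) w ^ σ) ∂ν := by
        refine lintegral_mono_ae (hν.mono fun w hw => ?_)
        have hk := bker_pos hw ha
        have hkh := one_sub_norm_le_bker (w := a) hw
        -- Here 2^j (1-|a|) ≤ |1-⟨w,a⟩| < 2^(j+1) (1-|a|), so (1-|a|²)/|1-⟨w,a⟩| is at most 2 ·
        -- 2^(-j): its t-th power is the geometric gain. Capping the scale at 1 is harmless because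
        -- the kernel is below 2.
        obtain ⟨j, hj1, hj2⟩ := exists_nat_pow_near (x := bker w a / (1 - ‖a‖)) (y := (2 : ℝ))
          ((one_le_div hh).2 hkh) (by norm_num)
        rw [le_div_iff₀ hh] at hj1
        rw [div_lt_iff₀ hh, pow_succ] at hj2
        refine le_trans ?_ (ENNReal.le_tsum j)
        rw [← ENNReal.ofReal_mul (by positivity)]
        refine ENNReal.ofReal_le_ofReal ?_
        have h := bker_rpow_neg_le hσ (min_le_left 1 (2 ^ j * (1 - ‖a‖))) hw ha
          (le_min (by linarith [bker_lt_two hw ha]) (by linarith))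
          ((min_le_right _ _).trans (by linarith))
        have e1 : rho a ^ t * bker w a ^ (-(t + σ))
            = (rho a / bker w a) ^ t * bker w a ^ (-σ) := by
          rw [neg_add, Real.rpow_add hk, Real.div_rpow (rho_pos ha).le hk.le, Real.rpow_neg hk.le]
          ring
        have e2 : (rho a / bker w a) ^ t ≤ 2 ^ t * ((1 / 2 : ℝ) ^ t) ^ j := by
          rw [← Real.rpow_natCast, ← Real.rpow_mul (by norm_num), mul_comm t,
            Real.rpow_mul (by norm_num), Real.rpow_natCast, ← Real.mul_rpow (by norm_num)
            (by positivity)]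
          refine Real.rpow_le_rpow (by have := rho_pos ha; positivity) ?_ ht.le
          rw [div_le_iff₀ hk]
          have r1 : rho a ≤ 2 * (1 - ‖a‖) := by
            unfold rho; nlinarith [sq_nonneg (1 - ‖a‖)]
          refine r1.trans ?_
          rw [mul_assoc]
          refine mul_le_mul_of_nonneg_left ?_ (by norm_num)
          rw [one_div, inv_pow, ← div_eq_inv_mul, le_div_iff₀ (by positivity)]
          linarith
        rw [e1]
        calc _ ≤ (2 ^ t * ((1 / 2 : ℝ) ^ t) ^ j) *
              (18 ^ σ * jac (shrink (min 1 (2 ^ j * (1 - ‖a‖))) a) w ^ σ) :=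
              mul_le_mul e2 h (by positivity) (by positivity)
          _ = _ := by ring
    _ ≤ ∑' j : ℕ, ENNReal.ofReal (2 ^ t * 18 ^ σ * ((1 / 2 : ℝ) ^ t) ^ j) * M := by
        rw [lintegral_tsum fun j => ((measurable_ofReal_jac _ _).const_mul _).aemeasurable]
        refine ENNReal.tsum_le_tsum fun j => ?_
        rw [lintegral_const_mul _ (measurable_ofReal_jac _ _)]
        gcongr
        exact hM _ (shrink_mem (hτ0 j) (min_le_left _ _) ha)
    _ = _ := by
        rw [ENNReal.tsum_mul_right, ← ENNReal.tsum_mul_left]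
        congr 2; ext j
        rw [ENNReal.ofReal_mul (by positivity)]

/-! ### The two-point Forelli-Rudin estimate -/

/-- Writing positive bases as exponentials reduces identities between real powers to linear
identities between exponents. -/
lemma exists_exp_eq {x : ℝ} (hx : 0 < x) : ∃ y, Real.exp y = x := ⟨Real.log x, Real.exp_log hx⟩

lemma bker_mobPhi_left {w u a : EuclideanSpace ℂ (Fin n)} (hw : w ∈ unitBall n)
    (hu : u ∈ unitBall n) (ha : a ∈ unitBall n) :
    bker (mobPhi w u) a = bker u (mobPhi w a) * bker w a / bker u w := by
  have hb := mobPhi_mem hw ha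
  have h1 := bker_mobPhi_mobPhi hw hu hb
  have h2 := bker_mobPhi hw hb
  rw [mobPhi_mobPhi hw ha] at h1 h2
  have p1 := bker_pos hb hw
  have p2 := bker_pos hu hw
  rw [bker_comm a w] at h2
  rw [h1, h2]
  field_simp

/-- Both factors are dominated by the corresponding power of the smaller of x and y; this separates
the two singularities. -/
lemma rpow_neg_mul_rpow_neg_le {x y e r : ℝ} (hx : 0 < x) (hy : 0 < y) (he : 0 ≤ e) (hr : 0 ≤ r) :
    x ^ (-e) * y ^ (-r) ≤ x ^ (-(e + r)) + y ^ (-(e + r)) := by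
  rcases le_total x y with h | h
  · have : y ^ (-r) ≤ x ^ (-r) := Real.rpow_le_rpow_of_nonpos hx h (by linarith)
    calc x ^ (-e) * y ^ (-r) ≤ x ^ (-e) * x ^ (-r) := by gcongr
      _ = x ^ (-(e + r)) := by rw [← Real.rpow_add hx]; ring_nf
      _ ≤ _ := le_add_of_nonneg_right (by positivity)
  · have : x ^ (-e) ≤ y ^ (-e) := Real.rpow_le_rpow_of_nonpos hy h (by linarith)
    calc x ^ (-e) * y ^ (-r) ≤ y ^ (-e) * y ^ (-r) := by gcongr
      _ = y ^ (-(e + r)) := by rw [← Real.rpow_add hy]; ring_nf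
      _ ≤ _ := le_add_of_nonneg_left (by positivity)

/-- Two-point Forelli-Rudin estimate. -/
theorem exists_lintegral_bker_mul_bker_le (hn : 1 ≤ n) {δ T r : ℝ} (hδ : -1 < δ)
    (hT : δ + n + 1 < T) (hr0 : 0 ≤ r) (hr : r < δ + n + 1) :
    ∃ C : ℝ≥0∞, C < ∞ ∧ ∀ w ∈ unitBall n, ∀ a ∈ unitBall n,
      ∫⁻ z, ENNReal.ofReal (bker z w ^ (-T) * bker z a ^ (-r)) ∂(bw n δ)
        ≤ C * ENNReal.ofReal (rho w ^ (δ + n + 1 - T) * bker w a ^ (-r)) := by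
  set σ := δ + n + 1 with hσ
  -- After z = Φ_w(u) the factor |1-⟨u,w⟩| carries exactly the exponent -e. A negative e gives only
  -- a bounded factor, hence e' = max e 0. The one-point estimate needs e' + r < σ: this follows
  -- from T > σ if e ≥ 0 and from r < σ otherwise.
  set e := 2 * σ - T - r with he
  set e' := max e 0 with he'
  have hc : e' + r < σ := by
    rcases max_cases e 0 with ⟨h, _⟩ | ⟨h, _⟩ <;> rw [he', h] <;> linarith
  obtain ⟨C, hC, hb⟩ := exists_lintegral_bker_le (c := e' + r) hn hδ (by rw [← hσ]; exact hc)
  refine ⟨ENNReal.ofReal (2 ^ |e|) * (C + C), ENNReal.mul_lt_top ENNReal.ofReal_lt_top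
    (ENNReal.add_lt_top.2 ⟨hC, hC⟩), fun w hw a ha => ?_⟩
  rw [lintegral_bw_mobPhi δ hw]
  have hrw := rho_pos hw
  have hwa := bker_pos hw ha
  have hba := mobPhi_mem hw ha
  calc _ ≤ ∫⁻ u, ENNReal.ofReal (2 ^ |e|) *
          ENNReal.ofReal (rho w ^ (σ - T) * bker w a ^ (-r)) *
          (ENNReal.ofReal (bker u w ^ (-(e' + r)))
            + ENNReal.ofReal (bker u (mobPhi w a) ^ (-(e' + r)))) ∂(bw n δ) := by
        refine lintegral_bw_mono fun u hu => ?_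
        have h1 := bker_pos hu hw
        have h2 := bker_pos hu hba
        rw [bker_mobPhi hw hu, bker_mobPhi_left hw hu ha, ← ENNReal.ofReal_add (by positivity)
          (by positivity), ← ENNReal.ofReal_mul (by positivity), ← ENNReal.ofReal_mul
          (by positivity), ← ENNReal.ofReal_mul (by positivity)]
        refine ENNReal.ofReal_le_ofReal ?_
        have e1 : (rho w / bker u w ^ 2) ^ (δ + n + 1) * ((rho w / bker u w) ^ (-T) *
            (bker u (mobPhi w a) * bker w a / bker u w) ^ (-r)) =
            (rho w ^ (σ - T) * bker w a ^ (-r)) * (bker u w ^ (-e) * bker u (mobPhi w a) ^ (-r)) := by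
          rw [← hσ]
          obtain ⟨x1, hx1⟩ := exists_exp_eq hrw
          obtain ⟨x2, hx2⟩ := exists_exp_eq hwa
          obtain ⟨x3, hx3⟩ := exists_exp_eq h1
          obtain ⟨x4, hx4⟩ := exists_exp_eq h2
          simp only [← hx1, ← hx2, ← hx3, ← hx4, ← Real.exp_nat_mul, ← Real.exp_sub, ← Real.exp_add,
            ← Real.exp_mul]
          congr 1
          push_cast
          rw [he]; ring
        have e2 : bker u w ^ (-e) ≤ 2 ^ |e| * bker u w ^ (-e') := by
          rcases max_cases e 0 with ⟨h, h'⟩ | ⟨h, h'⟩ <;> rw [he', h]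
          · exact le_mul_of_one_le_left (by positivity)
              (Real.one_le_rpow (by norm_num) (abs_nonneg e))
          · rw [abs_of_neg h', neg_zero, Real.rpow_zero, mul_one]
            exact Real.rpow_le_rpow h1.le (bker_lt_two hu hw).le (by linarith)
        have e3 := rpow_neg_mul_rpow_neg_le h1 h2 (le_max_right e 0) hr0
        rw [e1, mul_comm ((2:ℝ) ^ |e|), mul_assoc (rho w ^ (σ - T) * bker w a ^ (-r))]
        refine mul_le_mul_of_nonneg_left ?_ (by positivity)
        calc _ ≤ (2 ^ |e| * bker u w ^ (-e')) * bker u (mobPhi w a) ^ (-r) := by gcongr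
          _ ≤ _ := by rw [mul_assoc]; gcongr
    _ ≤ _ := by
        have m : ∀ b : EuclideanSpace ℂ (Fin n),
            Measurable fun u => ENNReal.ofReal (bker u b ^ (-(e' + r))) :=
          fun b => ((measurable_bker_left b).pow_const _).ennreal_ofReal
        rw [lintegral_const_mul' _ _ (ENNReal.mul_ne_top ENNReal.ofReal_ne_top
          ENNReal.ofReal_ne_top), lintegral_add_left (m w), mul_right_comm]
        gcongr
        · exact hb w hw
        · exact hb _ hba

/-! ### Sub-mean value properties -/

/-- Multiplication by a unimodular scalar as an isometry. -/
def ballRotation (c : ℂ) (hc : ‖c‖ = 1) :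
    EuclideanSpace ℂ (Fin n) ≃ₗᵢ[ℝ] EuclideanSpace ℂ (Fin n) where
  toLinearEquiv := (LinearEquiv.smulOfNeZero ℂ (EuclideanSpace ℂ (Fin n)) c
    (by rw [← norm_ne_zero_iff, hc]; exact one_ne_zero)).restrictScalars ℝ
  norm_map' x := by
    change ‖c • x‖ = ‖x‖
    rw [norm_smul, hc, one_mul]

lemma ballRotation_apply (c : ℂ) (hc : ‖c‖ = 1) (x : EuclideanSpace ℂ (Fin n)) :
    ballRotation c hc x = c • x := rfl

lemma lintegral_bw_smul (δ : ℝ) (c : ℂ) (hc : ‖c‖ = 1) (F : EuclideanSpace ℂ (Fin n) → ℝ≥0∞) :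
    ∫⁻ z, F (c • z) ∂(bw n δ) = ∫⁻ z, F z ∂(bw n δ) := by
  have hmp := (ballRotation (n := n) c hc).measurePreserving.restrict_preimage_emb
    (ballRotation (n := n) c hc).toHomeomorph.measurableEmbedding (unitBall n)
  have hpre : ballRotation (n := n) c hc ⁻¹' unitBall n = unitBall n := by
    ext x; simp [mem_unitBall]
  rw [hpre] at hmp
  rw [lintegral_bw, lintegral_bw, ← hmp.lintegral_comp_emb
    (ballRotation (n := n) c hc).toHomeomorph.measurableEmbedding
    (fun z => ENNReal.ofReal (rho z ^ δ) * F z)]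
  refine lintegral_congr fun z => ?_
  rw [ballRotation_apply, rho, rho, norm_smul, hc, one_mul]

/-- The normalized arc-length measure on `(0, 2π]`. -/
def circleProb : Measure ℝ :=
  ENNReal.ofReal (2 * Real.pi)⁻¹ • volume.restrict (Set.Ioc 0 (2 * Real.pi))

instance : IsProbabilityMeasure circleProb := by
  constructor
  have := Real.pi_pos
  rw [circleProb, Measure.smul_apply, Measure.restrict_apply_univ, Real.volume_Ioc, smul_eq_mul,
    ← ENNReal.ofReal_mul (by positivity), sub_zero, inv_mul_cancel₀ (by positivity),
    ENNReal.ofReal_one]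

lemma ofReal_norm_rpow {p : ℝ} (hp : 0 ≤ p) (x : ℂ) : ENNReal.ofReal (‖x‖ ^ p) = ‖x‖ₑ ^ p := by
  rw [← ENNReal.ofReal_rpow_of_nonneg (norm_nonneg x) hp, ofReal_norm]

lemma smul_mem_unitBall {u : EuclideanSpace ℂ (Fin n)} (hu : u ∈ unitBall n) {c : ℂ}
    (hc : ‖c‖ ≤ 1) : c • u ∈ unitBall n := by
  rw [mem_unitBall] at *
  rw [norm_smul]
  nlinarith [norm_nonneg u]

/-- The one-variable mean value property on the slice c ↦ g(c u), holomorphic near each point of the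
closed disc because |u| < 1, followed by monotonicity of L^p norms on a probability space. -/
lemma norm_rpow_le_lintegral_circle {p : ℝ} (hp : 1 ≤ p) {g : EuclideanSpace ℂ (Fin n) → ℂ}
    (hg : DifferentiableOn ℂ g (unitBall n)) {u : EuclideanSpace ℂ (Fin n)}
    (hu : u ∈ unitBall n) :
    ENNReal.ofReal (‖g 0‖ ^ p) ≤
      ∫⁻ θ, ENNReal.ofReal (‖g (circleMap 0 1 θ • u)‖ ^ p) ∂circleProb := by
  have hpi := Real.pi_pos
  have hmaps : Set.MapsTo (fun c : ℂ => c • u) (closedBall 0 1) (unitBall n) := fun c hc =>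
    smul_mem_unitBall hu (by simpa using hc)
  have hd : DifferentiableOn ℂ (fun c : ℂ => g (c • u)) (closedBall 0 1) :=
    hg.comp (by fun_prop) hmaps
  have hmean : Real.circleAverage (fun c : ℂ => g (c • u)) 0 1 = g 0 := by
    have : DiffContOnCl ℂ (fun c : ℂ => g (c • u)) (ball 0 |1|) := by
      rw [abs_one]; exact hd.diffContOnCl_ball subset_rfl
    rw [this.circleAverage, zero_smul]
  have hcont : Continuous fun θ : ℝ => g (circleMap 0 1 θ • u) :=
    hd.continuousOn.comp_continuous (continuous_circleMap 0 1) fun θ => by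
      simp [circleMap, Complex.norm_exp_ofReal_mul_I]
  have hint : g 0 = ∫ θ, g (circleMap 0 1 θ • u) ∂circleProb := by
    rw [← hmean, Real.circleAverage_def, circleProb, integral_smul_measure,
      ENNReal.toReal_ofReal (by positivity), intervalIntegral.integral_of_le (by positivity)]
  have h1 : ‖g 0‖ₑ ≤ eLpNorm' (fun θ => g (circleMap 0 1 θ • u)) 1 circleProb := by
    rw [eLpNorm']
    simp only [ENNReal.rpow_one, div_one]
    conv_lhs => rw [hint]
    exact enorm_integral_le_lintegral_enorm _
  have h2 := h1.trans (eLpNorm'_le_eLpNorm'_of_exponent_le one_pos hp circleProb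
    hcont.aestronglyMeasurable)
  simp only [ofReal_norm_rpow (zero_le_one.trans hp)]
  rw [eLpNorm', one_div, ENNReal.le_rpow_inv_iff (by linarith)] at h2
  exact h2

lemma measurable_ofReal_norm_rpow {X : Type*} [MeasurableSpace X] {g : X → ℂ} (hg : Measurable g)
    (p : ℝ) : Measurable fun z => ENNReal.ofReal (‖g z‖ ^ p) :=
  (hg.norm.pow_const p).ennreal_ofReal

/-- Sub-mean value property for powers of holomorphic functions in radial measures. -/
theorem norm_rpow_zero_mul_le {p : ℝ} (hp : 1 ≤ p) (δ : ℝ) {g : EuclideanSpace ℂ (Fin n) → ℂ}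
    (hgm : Measurable g) (hg : DifferentiableOn ℂ g (unitBall n)) :
    ENNReal.ofReal (‖g 0‖ ^ p) * bw n δ Set.univ ≤
      ∫⁻ u, ENNReal.ofReal (‖g u‖ ^ p) ∂(bw n δ) := by
  calc _ = ∫⁻ _, ENNReal.ofReal (‖g 0‖ ^ p) ∂(bw n δ) := by rw [lintegral_const]
    -- The circle average is taken at every u; after Fubini, rotation invariance of the radial
    -- measure makes the inner integral independent of θ.
    _ ≤ ∫⁻ u, ∫⁻ θ, ENNReal.ofReal (‖g (circleMap 0 1 θ • u)‖ ^ p) ∂circleProb ∂(bw n δ) :=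
        lintegral_bw_mono fun u hu => norm_rpow_le_lintegral_circle hp hg hu
    _ = ∫⁻ θ, ∫⁻ u, ENNReal.ofReal (‖g (circleMap 0 1 θ • u)‖ ^ p) ∂(bw n δ) ∂circleProb := by
        refine lintegral_lintegral_swap (Measurable.aemeasurable ?_)
        refine measurable_ofReal_norm_rpow (hgm.comp ?_) p
        have : Continuous fun x : EuclideanSpace ℂ (Fin n) × ℝ => circleMap 0 1 x.2 • x.1 := by
          fun_prop
        exact this.measurable
    _ = ∫⁻ _, ∫⁻ u, ENNReal.ofReal (‖g u‖ ^ p) ∂(bw n δ) ∂circleProb := by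
        refine lintegral_congr fun θ => ?_
        exact lintegral_bw_smul δ (circleMap 0 1 θ)
          (by simp [circleMap, Complex.norm_exp_ofReal_mul_I])
          fun u => ENNReal.ofReal (‖g u‖ ^ p)
    _ = _ := by rw [lintegral_const, measure_univ, mul_one]

lemma continuous_mobNum (a : EuclideanSpace ℂ (Fin n)) : Continuous (mobNum a) := by
  unfold mobNum; fun_prop

lemma measurable_mobPhi (a : EuclideanSpace ℂ (Fin n)) : Measurable (mobPhi a) := by
  unfold mobPhi
  have h : Continuous fun z => 1 - herm z a := by unfold herm; fun_prop
  exact h.measurable.inv.smul (continuous_mobNum a).measurable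

lemma differentiableOn_comp_mobPhi {f : EuclideanSpace ℂ (Fin n) → ℂ}
    (hf : DifferentiableOn ℂ f (unitBall n)) {a : EuclideanSpace ℂ (Fin n)}
    (ha : a ∈ unitBall n) : DifferentiableOn ℂ (fun u => f (mobPhi a u)) (unitBall n) :=
  hf.comp (fun _ hz => (hasFDerivAt_mobPhi ha hz).differentiableAt.differentiableWithinAt)
    fun _ hz => mobPhi_mem ha hz

/-- Möbius invariant sub-mean value property. -/
theorem norm_rpow_mul_le_lintegral_jac {p : ℝ} (hp : 1 ≤ p) (δ : ℝ)
    {f : EuclideanSpace ℂ (Fin n) → ℂ} (hfm : Measurable f)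
    (hf : DifferentiableOn ℂ f (unitBall n)) {z : EuclideanSpace ℂ (Fin n)}
    (hz : z ∈ unitBall n) :
    ENNReal.ofReal (‖f z‖ ^ p) * bw n δ Set.univ ≤
      ∫⁻ w, ENNReal.ofReal (jac z w ^ (δ + n + 1)) * ENNReal.ofReal (‖f w‖ ^ p) ∂(bw n δ) := by
  have h := norm_rpow_zero_mul_le hp δ (hfm.comp (measurable_mobPhi z))
    (differentiableOn_comp_mobPhi hf hz)
  simp only [Function.comp_apply, mobPhi_zero] at h
  refine h.trans_eq ?_
  rw [lintegral_bw_mobPhi δ hz]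
  refine lintegral_bw_congr fun w hw => ?_
  rw [mobPhi_mobPhi hz hw]
  rfl

/-! ### Comparability of kernels at bounded invariant distance -/

lemma bker_mem_Icc_of_norm_le_half {u v : EuclideanSpace ℂ (Fin n)} (hu : ‖u‖ ≤ 1 / 2)
    (hv : v ∈ unitBall n) : 1 / 2 ≤ bker u v ∧ bker u v ≤ 3 / 2 := by
  have h1 := one_sub_le_bker u v
  have h2 := bker_le u v
  rw [mem_unitBall] at hv
  have : ‖u‖ * ‖v‖ ≤ 1 / 2 := by nlinarith [norm_nonneg u, norm_nonneg v]
  constructor <;> linarith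

lemma mem_unitBall_of_le_half {u : EuclideanSpace ℂ (Fin n)} (hu : ‖u‖ ≤ 1 / 2) :
    u ∈ unitBall n := by rw [mem_unitBall]; linarith

lemma bker_mobPhi_le {x u v : EuclideanSpace ℂ (Fin n)} (hx : x ∈ unitBall n)
    (hu : ‖u‖ ≤ 1 / 2) (hv : v ∈ unitBall n) : bker v (mobPhi x u) ≤ 3 * bker v x := by
  have hu' := mem_unitBall_of_le_half hu
  rw [bker_comm, bker_mobPhi_left hx hu' hv, div_le_iff₀ (bker_pos hu' hx), bker_comm v x]
  have h1 := (bker_mem_Icc_of_norm_le_half hu (mobPhi_mem hx hv)).2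
  have h2 := (bker_mem_Icc_of_norm_le_half hu hx).1
  have := bker_pos hx hv
  nlinarith

lemma le_bker_mobPhi {x u v : EuclideanSpace ℂ (Fin n)} (hx : x ∈ unitBall n)
    (hu : ‖u‖ ≤ 1 / 2) (hv : v ∈ unitBall n) : bker v x ≤ 3 * bker v (mobPhi x u) := by
  have hu' := mem_unitBall_of_le_half hu
  rw [bker_comm v (mobPhi x u), bker_mobPhi_left hx hu' hv, ← mul_div_assoc,
    le_div_iff₀ (bker_pos hu' hx), bker_comm v x]
  have h1 := (bker_mem_Icc_of_norm_le_half hu (mobPhi_mem hx hv)).1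
  have h2 := (bker_mem_Icc_of_norm_le_half hu hx).2
  have := bker_pos hx hv
  nlinarith

lemma rho_mobPhi_le {x u : EuclideanSpace ℂ (Fin n)} (hx : x ∈ unitBall n)
    (hu : ‖u‖ ≤ 1 / 2) : rho (mobPhi x u) ≤ 4 * rho x := by
  have hu' := mem_unitBall_of_le_half hu
  have h2 := (bker_mem_Icc_of_norm_le_half hu hx).1
  rw [rho_mobPhi hx hu', div_le_iff₀ (by positivity)]
  have := rho_le_one u
  have := rho_pos hx
  have : 1 / 4 ≤ bker u x ^ 2 := by nlinarith
  nlinarith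

lemma le_rho_mobPhi {x u : EuclideanSpace ℂ (Fin n)} (hx : x ∈ unitBall n)
    (hu : ‖u‖ ≤ 1 / 2) : rho x ≤ 4 * rho (mobPhi x u) := by
  have hu' := mem_unitBall_of_le_half hu
  have h2 := (bker_mem_Icc_of_norm_le_half hu hx).2
  have h1 := (bker_mem_Icc_of_norm_le_half hu hx).1
  rw [rho_mobPhi hx hu', ← mul_div_assoc, le_div_iff₀ (by positivity)]
  have : 3 / 4 ≤ rho u := by unfold rho; nlinarith [norm_nonneg u]
  have := rho_pos hx
  have : bker u x ^ 2 ≤ 9 / 4 := by nlinarith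
  nlinarith

/-! ### Oscillation bounded by size -/

lemma add_rpow_le_two_rpow {x y p : ℝ} (hx : 0 ≤ x) (hy : 0 ≤ y) (hp : 0 ≤ p) :
    (x + y) ^ p ≤ 2 ^ p * (x ^ p + y ^ p) := by
  have hm : 0 ≤ max x y := le_max_of_le_left hx
  have h1 : (x + y) ^ p ≤ (2 * max x y) ^ p :=
    Real.rpow_le_rpow (by positivity) (by linarith [le_max_left x y, le_max_right x y]) hp
  rw [Real.mul_rpow (by norm_num) hm] at h1
  refine h1.trans (mul_le_mul_of_nonneg_left ?_ (by positivity))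
  rcases max_cases x y with ⟨h, _⟩ | ⟨h, _⟩ <;> rw [h]
  · exact le_add_of_nonneg_right (by positivity)
  · exact le_add_of_nonneg_left (by positivity)

lemma norm_sub_rpow_le {p : ℝ} (hp : 0 ≤ p) (x y : ℂ) :
    ‖x - y‖ ^ p ≤ 2 ^ p * (‖x‖ ^ p + ‖y‖ ^ p) :=
  (Real.rpow_le_rpow (norm_nonneg _) (norm_sub_le x y) hp).trans
    (add_rpow_le_two_rpow (norm_nonneg _) (norm_nonneg _) hp)

/-- The oscillation of a holomorphic function about the origin, divided by a power of `|u|` that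
the vanishing order absorbs, is controlled by its Bergman norm. -/
theorem exists_lintegral_osc_zero_le (hn : 1 ≤ n) {δ p κ : ℝ} (hδ : -1 < δ) (hp : 1 ≤ p)
    (hκ0 : 0 ≤ κ) (hκ : κ ≤ p) : ∃ C : ℝ≥0∞, C < ∞ ∧
      ∀ g : EuclideanSpace ℂ (Fin n) → ℂ, Measurable g → DifferentiableOn ℂ g (unitBall n) →
      ∫⁻ u, ENNReal.ofReal (‖g u - g 0‖ ^ p / ‖u‖ ^ κ) ∂(bw n δ) ≤
        C * ∫⁻ u, ENNReal.ofReal (‖g u‖ ^ p) ∂(bw n δ) := by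
  have : NeZero n := ⟨by omega⟩
  have hp0 : 0 < p := by linarith
  set V := bw n δ Set.univ with hV
  have hV0 : V ≠ 0 := by rw [hV]; exact (Measure.measure_univ_ne_zero).2 (NeZero.ne _)
  have hVt : V ≠ ∞ := (bw_univ_lt_top hn hδ).ne
  set σ := δ + n + 1 with hσ
  have hσ0 : 0 ≤ σ := by
    have : (0:ℝ) ≤ n := by positivity
    linarith
  set K : ℝ := 2 ^ κ * 6 ^ p with hK
  refine ⟨ENNReal.ofReal K * (1 + ENNReal.ofReal (4 ^ σ)), ENNReal.mul_lt_top
    ENNReal.ofReal_lt_top (ENNReal.add_lt_top.2 ⟨ENNReal.one_lt_top, ENNReal.ofReal_lt_top⟩),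
    fun g hgm hg => ?_⟩
  set M := ∫⁻ u, ENNReal.ofReal (‖g u‖ ^ p) ∂(bw n δ) with hM
  rcases eq_or_ne M ∞ with hMt | hMt
  · rw [hMt, ENNReal.mul_top]
    · exact le_top
    · have : (0:ℝ) < K := by positivity
      simp [this]
  -- S will bound |g|^p on the half ball: for |v| ≤ 1/2 one has `jac v w` ≤ 4, since the kernel is
  -- at least 1/2 and `rho v` ≤ 1.
  set S : ℝ := (ENNReal.ofReal (4 ^ σ) * M / V).toReal with hS
  have hSt : ENNReal.ofReal (4 ^ σ) * M / V ≠ ∞ :=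
    ENNReal.div_ne_top (ENNReal.mul_ne_top ENNReal.ofReal_ne_top hMt) hV0
  have hS0 : 0 ≤ S := ENNReal.toReal_nonneg
  have hsup : ∀ v : EuclideanSpace ℂ (Fin n), ‖v‖ ≤ 1 / 2 → ‖g v‖ ^ p ≤ S := by
    intro v hv
    have hvB := mem_unitBall_of_le_half hv
    have h := norm_rpow_mul_le_lintegral_jac hp δ hgm hg hvB
    rw [← ENNReal.ofReal_le_iff_le_toReal hSt, ENNReal.le_div_iff_mul_le (Or.inl hV0) (Or.inl hVt)]
    refine h.trans ?_
    rw [hM, ← lintegral_const_mul _ (measurable_ofReal_norm_rpow hgm p)]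
    refine lintegral_bw_mono fun w hw => ?_
    gcongr
    · exact (jac_pos hvB hw).le
    · have := (bker_mem_Icc_of_norm_le_half hv hw).1
      unfold jac
      rw [bker_comm, div_le_iff₀ (by positivity)]
      have := rho_le_one v
      nlinarith
  set R := S ^ p⁻¹ with hR
  have hR0 : 0 ≤ R := by positivity
  have hRp : R ^ p = S := Real.rpow_inv_rpow hS0 hp0.ne'
  have hsup' : ∀ v : EuclideanSpace ℂ (Fin n), ‖v‖ ≤ 1 / 2 → ‖g v‖ ≤ R := fun v hv =>
    (Real.le_rpow_inv_iff_of_pos (norm_nonneg _) hS0 hp0).2 (hsup v hv)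
  have hpt : ∀ u ∈ unitBall n, ‖g u - g 0‖ ^ p / ‖u‖ ^ κ ≤ K * (‖g u‖ ^ p + S) := by
    intro u hu
    have g0 := hsup 0 (by simp)
    rcases le_or_gt (1 / 2) ‖u‖ with h | h
    · rw [div_le_iff₀ (by positivity)]
      have a1 : (1:ℝ) ≤ 2 ^ κ * ‖u‖ ^ κ := by
        rw [← Real.mul_rpow (by norm_num) (norm_nonneg u)]
        exact Real.one_le_rpow (by linarith) hκ0
      have a2 : (2:ℝ) ^ p ≤ 6 ^ p := Real.rpow_le_rpow (by norm_num) (by norm_num) hp0.le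
      calc _ ≤ 2 ^ p * (‖g u‖ ^ p + ‖g 0‖ ^ p) := norm_sub_rpow_le hp0.le _ _
        _ ≤ 6 ^ p * (‖g u‖ ^ p + S) * 1 := by rw [mul_one]; gcongr
        _ ≤ 6 ^ p * (‖g u‖ ^ p + S) * (2 ^ κ * ‖u‖ ^ κ) := by gcongr
        _ = _ := by rw [hK]; ring
    · rcases eq_or_ne u 0 with rfl | hu0
      · rw [sub_self, norm_zero, Real.zero_rpow hp0.ne', zero_div]
        positivity
      have hun : 0 < ‖u‖ := norm_pos_iff.2 hu0
      -- Schwarz lemma on the ball of radius 1/2, where g stays within 2R of g(0): the slope is 4R,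
      -- relaxed to 6R below. With |u|^p ≤ |u|^κ this cancels the singularity.
      have hsch := Complex.dist_le_div_mul_dist_of_mapsTo_ball (f := g) (c := 0) (z := u)
        (R₁ := 1 / 2) (R₂ := 2 * R)
        (hg.mono (ball_subset_ball (by norm_num)))
        (fun v hv => by
          rw [mem_closedBall, dist_eq_norm]
          rw [mem_ball_zero_iff] at hv
          have := norm_sub_le (g v) (g 0)
          linarith [hsup' v hv.le, hsup' 0 (by simp)]) (by simpa using h)
      rw [dist_eq_norm, dist_zero_right] at hsch
      have hle : ‖g u - g 0‖ ≤ 6 * R * ‖u‖ := hsch.trans (by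
        refine mul_le_mul_of_nonneg_right ?_ hun.le
        linarith)
      rw [div_le_iff₀ (by positivity)]
      calc ‖g u - g 0‖ ^ p ≤ (6 * R * ‖u‖) ^ p := Real.rpow_le_rpow (norm_nonneg _) hle hp0.le
        _ = 6 ^ p * S * ‖u‖ ^ p := by
          rw [Real.mul_rpow (by positivity) hun.le, Real.mul_rpow (by norm_num) hR0, hRp]
        _ ≤ 6 ^ p * S * ‖u‖ ^ κ := by
          gcongr ?_ * ?_
          exact Real.rpow_le_rpow_of_exponent_ge hun (by linarith) hκ
        _ ≤ 2 ^ κ * 6 ^ p * (‖g u‖ ^ p + S) * ‖u‖ ^ κ := by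
          gcongr ?_ * _
          have : (1:ℝ) ≤ 2 ^ κ := Real.one_le_rpow (by norm_num) hκ0
          have b : S ≤ ‖g u‖ ^ p + S := le_add_of_nonneg_left (by positivity)
          calc 6 ^ p * S = 1 * 6 ^ p * S := by ring
            _ ≤ _ := by gcongr
  calc _ ≤ ∫⁻ u, ENNReal.ofReal K * (ENNReal.ofReal (‖g u‖ ^ p) + ENNReal.ofReal S) ∂(bw n δ) := by
        refine lintegral_bw_mono fun u hu => ?_
        rw [← ENNReal.ofReal_add (by positivity) hS0, ← ENNReal.ofReal_mul (by positivity)]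
        exact ENNReal.ofReal_le_ofReal (hpt u hu)
    _ = ENNReal.ofReal K * (M + ENNReal.ofReal S * V) := by
        rw [lintegral_const_mul' _ _ ENNReal.ofReal_ne_top, lintegral_add_right _ measurable_const,
          lintegral_const]
    _ = _ := by
        rw [hS, ENNReal.ofReal_toReal hSt, ENNReal.div_mul_cancel hV0 hVt]
        ring

/-- The weighted oscillation integral of `f` about the point `z`. -/
def oscInt (f : EuclideanSpace ℂ (Fin n) → ℂ) (p κ α : ℝ) (z : EuclideanSpace ℂ (Fin n)) : ℝ≥0∞ :=
  ∫⁻ w, ENNReal.ofReal (‖f z - f w‖ ^ p / ‖mobNum w z‖ ^ κ) ∂(bw n α)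

lemma norm_mobNum_mobPhi {z u : EuclideanSpace ℂ (Fin n)} (hz : z ∈ unitBall n)
    (hu : u ∈ unitBall n) : ‖mobNum (mobPhi z u) z‖ = ‖u‖ * (rho z / bker u z) := by
  have h := mobPhi_mem hz hu
  rw [norm_mobNum_eq_mobPhi hz h, mobPhi_mobPhi hz hu, bker_comm, bker_mobPhi hz hu]

/-- Substituting w = Φ_z(u) on both sides produces the same factor (1-|z|²)^(-m), so the estimate is
the one at the origin for f ∘ Φ_z. -/
theorem exists_oscInt_le (hn : 1 ≤ n) {α p m : ℝ} (hα : -1 < α) (hm : m = α + n + 1)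
    (hp : 1 ≤ p) (hmp : 2 * m ≤ p) : ∃ C : ℝ≥0∞, C < ∞ ∧
      ∀ f : EuclideanSpace ℂ (Fin n) → ℂ, Measurable f → DifferentiableOn ℂ f (unitBall n) →
      ∀ z ∈ unitBall n, oscInt f p (2 * m) α z ≤
        C * ∫⁻ w, ENNReal.ofReal (‖f w‖ ^ p * bker w z ^ (-(2 * m))) ∂(bw n α) := by
  have hm0 : 0 ≤ m := by
    have : (0:ℝ) ≤ n := by positivity
    linarith
  obtain ⟨C, hC, h⟩ := exists_lintegral_osc_zero_le hn hα hp (κ := 2 * m) (by linarith) hmp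
  refine ⟨C, hC, fun f hfm hf z hz => ?_⟩
  have hrz := rho_pos hz
  have key := h _ (hfm.comp (measurable_mobPhi z)) (differentiableOn_comp_mobPhi hf hz)
  simp only [Function.comp_apply, mobPhi_zero] at key
  have e1 : oscInt f p (2 * m) α z = ENNReal.ofReal (rho z ^ (-m)) *
      ∫⁻ u, ENNReal.ofReal (‖f (mobPhi z u) - f z‖ ^ p / ‖u‖ ^ (2 * m)) ∂(bw n α) := by
    rw [oscInt, lintegral_bw_mobPhi α hz, ← lintegral_const_mul' _ _ ENNReal.ofReal_ne_top]
    refine lintegral_bw_congr fun u hu => ?_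
    have hk := bker_pos hu hz
    rw [norm_mobNum_mobPhi hz hu, ← ENNReal.ofReal_mul (by positivity),
      ← ENNReal.ofReal_mul (by positivity), norm_sub_rev, ← hm,
      Real.mul_rpow (norm_nonneg u) (by positivity)]
    have : (rho z / bker u z ^ 2) ^ m = rho z ^ (-m) * (rho z / bker u z) ^ (2 * m) := by
      obtain ⟨x1, hx1⟩ := exists_exp_eq hrz
      obtain ⟨x2, hx2⟩ := exists_exp_eq hk
      simp only [← hx1, ← hx2, ← Real.exp_nat_mul, ← Real.exp_sub, ← Real.exp_add, ← Real.exp_mul]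
      congr 1; push_cast; ring
    rw [this]
    have h2 : (rho z / bker u z) ^ (2 * m) ≠ 0 := by positivity
    congr 1
    rw [mul_assoc, ← mul_div_assoc ((rho z / bker u z) ^ (2 * m)),
      mul_comm ((rho z / bker u z) ^ (2 * m)), mul_div_mul_right _ _ h2]
  have e2 : ∫⁻ w, ENNReal.ofReal (‖f w‖ ^ p * bker w z ^ (-(2 * m))) ∂(bw n α)
      = ENNReal.ofReal (rho z ^ (-m)) *
        ∫⁻ u, ENNReal.ofReal (‖f (mobPhi z u)‖ ^ p) ∂(bw n α) := by
    rw [lintegral_bw_mobPhi α hz, ← lintegral_const_mul' _ _ ENNReal.ofReal_ne_top]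
    refine lintegral_bw_congr fun u hu => ?_
    have hk := bker_pos hu hz
    rw [bker_mobPhi hz hu, ← ENNReal.ofReal_mul (by positivity),
      ← ENNReal.ofReal_mul (by positivity), ← hm]
    have : (rho z / bker u z ^ 2) ^ m * (rho z / bker u z) ^ (-(2 * m)) = rho z ^ (-m) := by
      obtain ⟨x1, hx1⟩ := exists_exp_eq hrz
      obtain ⟨x2, hx2⟩ := exists_exp_eq hk
      simp only [← hx1, ← hx2, ← Real.exp_nat_mul, ← Real.exp_sub, ← Real.exp_add, ← Real.exp_mul]
      congr 1; push_cast; ring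
    rw [← this]; congr 1; ring
  rw [e1, e2]
  calc _ ≤ ENNReal.ofReal (rho z ^ (-m)) *
        (C * ∫⁻ u, ENNReal.ofReal (‖f (mobPhi z u)‖ ^ p) ∂(bw n α)) := by gcongr
    _ = _ := by ring

lemma norm_mobNum_le_bker {z w : EuclideanSpace ℂ (Fin n)} (hz : z ∈ unitBall n)
    (hw : w ∈ unitBall n) : ‖mobNum w z‖ ≤ bker w z := by
  have h := norm_mobNum_sq hw z
  rw [bker_comm] at h
  have := mul_pos (rho_pos hw) (rho_pos hz)
  exact le_of_sq_le_sq (by linarith) (bker_pos hw hz).le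

lemma eq_of_mobNum_eq_zero {z w : EuclideanSpace ℂ (Fin n)} (hz : z ∈ unitBall n)
    (hw : w ∈ unitBall n) (h : ‖mobNum w z‖ = 0) : z = w := by
  have h1 : mobPhi w z = 0 := by
    rw [← norm_eq_zero, norm_mobPhi, h, zero_div]
  rw [← mobPhi_mobPhi hw hz, h1, mobPhi_zero]

lemma lintegral_le_oscInt {p κ : ℝ} (α : ℝ) (hp : 0 < p) (hκ : 0 ≤ κ)
    (f : EuclideanSpace ℂ (Fin n) → ℂ) {z : EuclideanSpace ℂ (Fin n)} (hz : z ∈ unitBall n) :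
    ∫⁻ w, ENNReal.ofReal (‖f w - f z‖ ^ p * bker w z ^ (-κ)) ∂(bw n α) ≤ oscInt f p κ α z := by
  refine lintegral_bw_mono fun w hw => ENNReal.ofReal_le_ofReal ?_
  have hk := bker_pos hw hz
  rw [norm_sub_rev, Real.rpow_neg hk.le, ← div_eq_mul_inv]
  -- On the diagonal the quotient on the right is 0 by the division convention, but there w = z and
  -- the left side vanishes too.
  rcases eq_or_ne ‖mobNum w z‖ 0 with h | h
  · rw [eq_of_mobNum_eq_zero hz hw h, sub_self, norm_zero, Real.zero_rpow hp.ne', zero_div, zero_div]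
  · have h' : 0 < ‖mobNum w z‖ := (norm_nonneg _).lt_of_ne' h
    gcongr
    exact norm_mobNum_le_bker hz hw

/-! ### Increments bounded by oscillation -/

/-- The invariant form of the oscillation integral. -/
def oscInv (f : EuclideanSpace ℂ (Fin n) → ℂ) (p m α : ℝ) (z : EuclideanSpace ℂ (Fin n)) : ℝ≥0∞ :=
  ENNReal.ofReal (rho z ^ m) * oscInt f p (2 * m) α z

lemma lintegral_jac_le_oscInv {p m : ℝ} (α : ℝ) (hp : 0 < p) (hm : 0 ≤ m)
    (f : EuclideanSpace ℂ (Fin n) → ℂ) {z : EuclideanSpace ℂ (Fin n)} (hz : z ∈ unitBall n) :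
    ∫⁻ w, ENNReal.ofReal (jac z w ^ m) * ENNReal.ofReal (‖f w - f z‖ ^ p) ∂(bw n α)
      ≤ oscInv f p m α z := by
  unfold oscInv
  refine le_trans (le_of_eq ?_) (mul_le_mul_right (lintegral_le_oscInt α hp (κ := 2 * m)
    (by linarith) f hz) _)
  rw [← lintegral_const_mul' _ _ ENNReal.ofReal_ne_top]
  refine lintegral_bw_congr fun w hw => ?_
  have hk := bker_pos hw hz
  have hr := rho_pos hz
  rw [← ENNReal.ofReal_mul (by have := jac_pos hz hw; positivity), ← ENNReal.ofReal_mul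
    (by positivity)]
  have : jac z w ^ m = rho z ^ m * bker w z ^ (-(2 * m)) := by
    unfold jac
    rw [Real.div_rpow hr.le (by positivity), Real.rpow_neg hk.le, Real.rpow_mul hk.le,
      Real.rpow_two, div_eq_mul_inv]
  rw [this]; congr 1; ring

/-- Both points are within invariant distance 1/2 of x: passing through x costs 4·4 for 1-|·|² and
(3·3)² for the squared kernel, and 16·81 = 1296. -/
lemma jac_mobPhi_le {x u v ζ : EuclideanSpace ℂ (Fin n)} (hx : x ∈ unitBall n)
    (hu : ‖u‖ ≤ 1 / 2) (hv : ‖v‖ ≤ 1 / 2) (hζ : ζ ∈ unitBall n) :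
    jac (mobPhi x u) ζ ≤ 1296 * jac (mobPhi x v) ζ := by
  have hu' := mobPhi_mem hx (mem_unitBall_of_le_half hu)
  have hv' := mobPhi_mem hx (mem_unitBall_of_le_half hv)
  have h1 := le_bker_mobPhi hx hu hζ
  have h2 := bker_mobPhi_le hx hv hζ
  have h3 := rho_mobPhi_le hx hu
  have h4 := le_rho_mobPhi hx hv
  have p1 := bker_pos hζ hu'
  have p2 := bker_pos hζ hv'
  have p3 := rho_pos hv'
  have p4 := bker_pos hζ hx
  unfold jac
  rw [← mul_div_assoc, div_le_div_iff₀ (by positivity) (by positivity)]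
  have h5 : bker ζ (mobPhi x v) ≤ 9 * bker ζ (mobPhi x u) := by linarith
  have h6 : bker ζ (mobPhi x v) ^ 2 ≤ 81 * bker ζ (mobPhi x u) ^ 2 := by nlinarith
  calc rho (mobPhi x u) * bker ζ (mobPhi x v) ^ 2
      ≤ (16 * rho (mobPhi x v)) * (81 * bker ζ (mobPhi x u) ^ 2) := by
        gcongr; linarith
    _ = _ := by ring

/-- With y = Φ_x(v), apply the invariant sub-mean value property to f - f(y) at Φ_x(u), then replace
the Jacobian at Φ_x(u) by the comparable one at y. -/
lemma osc_mul_le_oscInv {p m α : ℝ} (hp : 1 ≤ p) (hm0 : 0 ≤ m) (hm : m = α + n + 1)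
    {f : EuclideanSpace ℂ (Fin n) → ℂ} (hfm : Measurable f)
    (hf : DifferentiableOn ℂ f (unitBall n)) {x u v : EuclideanSpace ℂ (Fin n)}
    (hx : x ∈ unitBall n) (hu : ‖u‖ ≤ 1 / 2) (hv : ‖v‖ ≤ 1 / 2) :
    ENNReal.ofReal (‖f (mobPhi x u) - f (mobPhi x v)‖ ^ p) * bw n α Set.univ ≤
      ENNReal.ofReal (1296 ^ m) * oscInv f p m α (mobPhi x v) := by
  have hu' := mobPhi_mem hx (mem_unitBall_of_le_half hu)
  have hv' := mobPhi_mem hx (mem_unitBall_of_le_half hv)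
  refine (norm_rpow_mul_le_lintegral_jac hp α (hfm.sub_const (f (mobPhi x v)))
    (hf.sub_const _) hu').trans ?_
  refine le_trans ?_ (mul_le_mul_right (lintegral_jac_le_oscInv α (by linarith) hm0 f hv') _)
  rw [← lintegral_const_mul' _ _ ENNReal.ofReal_ne_top, ← hm]
  refine lintegral_bw_mono fun ζ hζ => ?_
  have h1 := jac_pos hu' hζ
  have h2 := jac_pos hv' hζ
  rw [← mul_assoc, ← ENNReal.ofReal_mul (p := 1296 ^ m) (by positivity), ← Real.mul_rpow (by norm_num) h2.le]
  gcongr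
  exact jac_mobPhi_le hx hu hv hζ

lemma bw_closedBall_half_ne_zero (δ : ℝ) :
    bw n δ (closedBall 0 (1 / 2)) ≠ 0 := by
  intro h
  have hac : volume.restrict (unitBall n) ≪ bw n δ := by
    refine withDensity_absolutelyContinuous' (measurable_ofReal_rho_rpow δ).aemeasurable ?_
    refine (ae_restrict_mem measurableSet_unitBall).mono fun z hz => ?_
    have := rho_pos hz
    simpa using Real.rpow_pos_of_pos this δ
  have h2 := hac h
  rw [Measure.restrict_apply measurableSet_closedBall, Set.inter_eq_left.2] at h2
  · exact (measure_closedBall_pos volume (0 : EuclideanSpace ℂ (Fin n))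
      (by norm_num : (0:ℝ) < 1 / 2)).ne' h2
  · exact closedBall_subset_ball (by norm_num)

/-- Increments over bounded invariant distance are controlled by averages of the oscillation. -/
theorem exists_norm_sub_rpow_le (hn : 1 ≤ n) {p m α : ℝ} (hα : -1 < α) (hp : 1 ≤ p)
    (hm : m = α + n + 1) {η A : ℝ} (hη : -1 < η) (hA : A = η + n + 1) :
    ∃ C : ℝ≥0∞, C < ∞ ∧
      ∀ f : EuclideanSpace ℂ (Fin n) → ℂ, Measurable f → DifferentiableOn ℂ f (unitBall n) →
      ∀ x ∈ unitBall n, ∀ u : EuclideanSpace ℂ (Fin n), ‖u‖ ≤ 1 / 2 →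
      ENNReal.ofReal (‖f (mobPhi x u) - f x‖ ^ p) ≤
        C * ∫⁻ w, ENNReal.ofReal (jac x w ^ A) * oscInv f p m α w ∂(bw n η) := by
  have hne : NeZero n := ⟨by omega⟩
  have hm0 : 0 ≤ m := by
    have : (0:ℝ) ≤ n := by positivity
    linarith
  set V := bw n α Set.univ with hV
  have hV0 : V ≠ 0 := by rw [hV]; exact (Measure.measure_univ_ne_zero).2 (NeZero.ne _)
  have hVt : V ≠ ∞ := (bw_univ_lt_top hn hα).ne
  set W := bw n η (closedBall 0 (1 / 2)) with hW
  have hW0 : W ≠ 0 := bw_closedBall_half_ne_zero η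
  have hWt : W ≠ ∞ := ((measure_mono (Set.subset_univ _)).trans_lt (bw_univ_lt_top hn hη)).ne
  refine ⟨(ENNReal.ofReal (2 ^ p) * (ENNReal.ofReal (1296 ^ m) + ENNReal.ofReal (1296 ^ m)))
    / (V * W), ENNReal.div_lt_top (by finiteness) (mul_ne_zero hV0 hW0),
    fun f hfm hf x hx u hu => ?_⟩
  set K := ENNReal.ofReal (2 ^ p) * (ENNReal.ofReal (1296 ^ m) + ENNReal.ofReal (1296 ^ m)) with hK
  have hKt : K ≠ ∞ := by rw [hK]; finiteness
  -- Every v in the half ball serves as an intermediate point between Φ_x(u) and x; integrating over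
  -- all such v replaces a pointwise value of `oscInv` by an average.
  have hpt : ∀ v : EuclideanSpace ℂ (Fin n), ‖v‖ ≤ 1 / 2 →
      ENNReal.ofReal (‖f (mobPhi x u) - f x‖ ^ p) * V ≤ K * oscInv f p m α (mobPhi x v) := by
    intro v hv
    have h1 := osc_mul_le_oscInv hp hm0 hm hfm hf hx hu hv
    have h2 := osc_mul_le_oscInv hp hm0 hm hfm hf hx (u := 0) (by simp) hv
    rw [mobPhi_zero] at h2
    have h3 := norm_sub_rpow_le (by linarith : 0 ≤ p) (f (mobPhi x u) - f (mobPhi x v))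
      (f x - f (mobPhi x v))
    rw [sub_sub_sub_cancel_right] at h3
    calc _ ≤ ENNReal.ofReal (2 ^ p) * (ENNReal.ofReal (‖f (mobPhi x u) - f (mobPhi x v)‖ ^ p)
          + ENNReal.ofReal (‖f x - f (mobPhi x v)‖ ^ p)) * V := by
          rw [← ENNReal.ofReal_add (by positivity) (by positivity), ← ENNReal.ofReal_mul
            (by positivity)]
          gcongr
      _ = ENNReal.ofReal (2 ^ p) * (ENNReal.ofReal (‖f (mobPhi x u) - f (mobPhi x v)‖ ^ p) * V
          + ENNReal.ofReal (‖f x - f (mobPhi x v)‖ ^ p) * V) := by ring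
      _ ≤ ENNReal.ofReal (2 ^ p) * (ENNReal.ofReal (1296 ^ m) * oscInv f p m α (mobPhi x v) +
          ENNReal.ofReal (1296 ^ m) * oscInv f p m α (mobPhi x v)) := by gcongr
      _ = _ := by rw [hK]; ring
  have hI : ∫⁻ w, ENNReal.ofReal (jac x w ^ A) * oscInv f p m α w ∂(bw n η)
      = ∫⁻ v, oscInv f p m α (mobPhi x v) ∂(bw n η) := by
    rw [lintegral_bw_mobPhi η hx (fun v => oscInv f p m α (mobPhi x v)), hA]
    refine lintegral_bw_congr fun w hw => ?_
    rw [mobPhi_mobPhi hx hw]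
    rfl
  rw [hI, ENNReal.mul_comm_div, ← mul_div_assoc,
    ENNReal.le_div_iff_mul_le (Or.inl (mul_ne_zero hV0 hW0)) (Or.inl (ENNReal.mul_ne_top hVt hWt)),
    ← mul_assoc]
  calc _ = ∫⁻ _ in closedBall 0 (1 / 2),
        ENNReal.ofReal (‖f (mobPhi x u) - f x‖ ^ p) * V ∂(bw n η) := by
        rw [setLIntegral_const]
    _ ≤ ∫⁻ v in closedBall 0 (1 / 2), K * oscInv f p m α (mobPhi x v) ∂(bw n η) :=
        setLIntegral_mono' measurableSet_closedBall fun v hv => hpt v (by simpa using hv)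
    _ ≤ ∫⁻ v, K * oscInv f p m α (mobPhi x v) ∂(bw n η) := setLIntegral_le_lintegral _ _
    _ = _ := by rw [lintegral_const_mul' _ _ hKt]

/-! ### Radial chains and pointwise growth -/

lemma shrink_zero (z : EuclideanSpace ℂ (Fin n)) : shrink 0 z = z := by simp [shrink]

lemma shrink_one (z : EuclideanSpace ℂ (Fin n)) : shrink 1 z = 0 := by simp [shrink]

/-- On a common radius the invariant distance has the one-variable form (τ'-τ)|z| /
(1-(1-τ)(1-τ')|z|²); the hypothesis `h` says that it is at most 1/2. -/
lemma exists_mobPhi_shrink_eq {z : EuclideanSpace ℂ (Fin n)} (hz : z ∈ unitBall n) {τ τ' : ℝ}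
    (h0 : 0 ≤ τ) (h1 : τ ≤ τ') (h2 : τ' ≤ 1)
    (h : 2 * ((τ' - τ) * ‖z‖) ≤ 1 - (1 - τ) * (1 - τ') * ‖z‖ ^ 2) :
    ∃ u : EuclideanSpace ℂ (Fin n), ‖u‖ ≤ 1 / 2 ∧ mobPhi (shrink τ' z) u = shrink τ z := by
  have hx := shrink_mem (h0.trans h1) h2 hz
  have hy := shrink_mem h0 (h1.trans h2) hz
  refine ⟨mobPhi (shrink τ' z) (shrink τ z), ?_, mobPhi_mobPhi hx hy⟩
  have hk := bker_pos hy hx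
  have hpos : 0 ≤ 2 * ((τ' - τ) * ‖z‖) := by have := sub_nonneg.2 h1; positivity
  have hb : bker (shrink τ z) (shrink τ' z) = 1 - (1 - τ) * (1 - τ') * ‖z‖ ^ 2 := by
    have : 1 - herm (shrink τ z) (shrink τ' z)
        = ((1 - (1 - τ) * (1 - τ') * ‖z‖ ^ 2 : ℝ) : ℂ) := by
      rw [herm_shrink, shrink, herm_smul_left, herm_self]; push_cast; ring
    rw [bker, this, Complex.norm_real, Real.norm_of_nonneg (hpos.trans h)]
  have hm := norm_mobNum_sq hx (shrink τ z)
  rw [hb, rho, rho, norm_shrink h2, norm_shrink (h1.trans h2)] at hm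
  have hm2 : ‖mobNum (shrink τ' z) (shrink τ z)‖ = (τ' - τ) * ‖z‖ := by
    rw [← pow_left_inj₀ (norm_nonneg _) (by have := sub_nonneg.2 h1; positivity) two_ne_zero, hm]
    ring
  rw [norm_mobPhi, hm2, div_le_iff₀ hk, hb]
  linarith

/-- The kernel at the retracted point is at least τ and at least half of |1-⟨w,z⟩|. Its power 2A is
split as (A+θ)+(A-θ), one bound for each part; `rho` at the retracted point is at most 4τ, leaving
τ^(-θ). -/
lemma jac_shrink_rpow_le {z w : EuclideanSpace ℂ (Fin n)} (hz : z ∈ unitBall n)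
    (hw : w ∈ unitBall n) {τ A θ : ℝ} (h0 : 1 - ‖z‖ ≤ τ) (h1 : τ ≤ 1) (hθ0 : 0 < θ)
    (hθA : θ ≤ A) :
    jac (shrink τ z) w ^ A ≤ 4 ^ A * 2 ^ (A - θ) * (τ ^ (-θ) * bker w z ^ (θ - A)) := by
  have hr : 0 < 1 - ‖z‖ := by rw [mem_unitBall] at hz; linarith
  have hτ : 0 < τ := by linarith
  have hx := shrink_mem hτ.le h1 hz
  have hkx := bker_pos hw hx
  have hkz := bker_pos hw hz
  have b1 := le_bker_shrink h1 hw hz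
  have b2 := (abs_le.1 (abs_bker_shrink_sub_le hτ.le hw hz)).1
  have b3 : bker w z ≤ 2 * bker w (shrink τ z) := by linarith
  have hrho : rho (shrink τ z) ≤ 4 * τ := by
    unfold rho
    rw [norm_shrink h1]
    have : 0 ≤ (1 - τ) * ‖z‖ := mul_nonneg (by linarith) (norm_nonneg _)
    nlinarith [sq_nonneg (1 - (1 - τ) * ‖z‖), norm_nonneg z]
  have hrho0 := rho_pos hx
  have e1 : bker w (shrink τ z) ^ (-(A + θ)) ≤ τ ^ (-(A + θ)) :=
    Real.rpow_le_rpow_of_nonpos hτ b1 (by linarith)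
  have e2 : bker w (shrink τ z) ^ (-(A - θ)) ≤ (bker w z / 2) ^ (-(A - θ)) :=
    Real.rpow_le_rpow_of_nonpos (by positivity) (by linarith) (by linarith)
  have e0 : rho (shrink τ z) ^ A ≤ (4 * τ) ^ A := Real.rpow_le_rpow hrho0.le hrho (by linarith)
  have : jac (shrink τ z) w ^ A = rho (shrink τ z) ^ A *
      (bker w (shrink τ z) ^ (-(A + θ)) * bker w (shrink τ z) ^ (-(A - θ))) := by
    rw [← Real.rpow_add hkx, jac, Real.div_rpow hrho0.le (by positivity), ← Real.rpow_two,
      ← Real.rpow_mul hkx.le, div_eq_mul_inv, ← Real.rpow_neg hkx.le]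
    ring_nf
  rw [this]
  calc _ ≤ (4 * τ) ^ A * (τ ^ (-(A + θ)) * (bker w z / 2) ^ (-(A - θ))) := by gcongr
    _ = _ := by
      rw [Real.mul_rpow (by norm_num) hτ.le, Real.div_rpow hkz.le (by norm_num), neg_add,
        Real.rpow_add hτ, Real.rpow_neg hτ.le A, Real.rpow_neg (by norm_num : (0:ℝ) ≤ 2), neg_sub]
      field_simp

/-- Pointwise growth of a holomorphic function in terms of its oscillation integrals. -/
theorem exists_norm_sub_zero_rpow_le (hn : 1 ≤ n) {p m α : ℝ} (hα : -1 < α) (hp : 1 ≤ p)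
    (hm : m = α + n + 1) {η A θ : ℝ} (hη : -1 < η) (hA : A = η + n + 1) (hθ0 : 0 < θ)
    (hθA : θ ≤ A) :
    ∃ C : ℝ≥0∞, C < ∞ ∧
      ∀ f : EuclideanSpace ℂ (Fin n) → ℂ, Measurable f → DifferentiableOn ℂ f (unitBall n) →
      ∀ z ∈ unitBall n, ENNReal.ofReal (‖f z - f 0‖ ^ p) ≤
        C * (ENNReal.ofReal (rho z ^ (-θ)) *
          ∫⁻ w, ENNReal.ofReal (bker w z ^ (θ - A)) * oscInv f p m α w ∂(bw n η)) := by
  obtain ⟨C₁, hC₁, hstep⟩ := exists_norm_sub_rpow_le hn hα hp hm hη hA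
  have hp0 : 0 < p := by linarith
  set D : ℝ := 4 ^ A * 2 ^ (A - θ) * 4 ^ θ with hD
  have hD0 : 0 < D := by positivity
  set q : ℝ := (1 / 2) ^ θ with hq
  have hq0 : 0 < q := by positivity
  have hq1 : q < 1 := half_rpow_lt_one hθ0
  set ρ : ℝ := q ^ p⁻¹ with hρ
  have hρ0 : 0 < ρ := by positivity
  have hρ1 : ρ < 1 := Real.rpow_lt_one hq0.le hq1 (by positivity)
  set E : ℝ := ((1 - ρ)⁻¹) ^ p with hE
  have hE0 : 0 < E := by have := sub_pos.2 hρ1; positivity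
  -- The summand 1 keeps the constant nonzero, so that the bound is trivial when the integral on the
  -- right is infinite.
  refine ⟨ENNReal.ofReal E * (C₁ * ENNReal.ofReal D + 1), by finiteness, fun f hfm hf z hz => ?_⟩
  set I := ENNReal.ofReal (rho z ^ (-θ)) *
          ∫⁻ w, ENNReal.ofReal (bker w z ^ (θ - A)) * oscInv f p m α w ∂(bw n η) with hI
  rcases eq_or_ne I ∞ with hIt | hIt
  · rw [hIt, ENNReal.mul_top]
    · exact le_top
    · simp [hE0]
  have hzr : ‖z‖ < 1 := mem_unitBall.1 hz
  have hrz := rho_pos hz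
  set h := 1 - ‖z‖ with hh
  have hh0 : 0 < h := by linarith
  have hh1 : h ≤ 1 := by linarith [norm_nonneg z]
  have hrh : rho z ≤ 2 * h := by unfold rho; nlinarith [sq_nonneg (1 - ‖z‖)]
  -- The chain starts at z itself (τ = 0), jumps to depth h = 1-|z|, then doubles the depth until it
  -- reaches the origin (τ = 1).
  set τ : ℕ → ℝ := fun i => Nat.casesOn i 0 fun j => min 1 (2 ^ j * h) with hτ
  have hτs : ∀ j, τ (j + 1) = min 1 (2 ^ j * h) := fun j => rfl
  have hτ0 : τ 0 = 0 := rfl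
  have hτnn : ∀ i, 0 ≤ τ i := by
    rintro (_ | j)
    · exact le_rfl
    · rw [hτs]; positivity
  have hτle : ∀ i, τ i ≤ 1 := by
    rintro (_ | j)
    · rw [hτ0]; norm_num
    · exact min_le_left _ _
  have hle : ∀ j : ℕ, h ≤ τ (j + 1) := fun j => by
    rw [hτs]
    exact le_min hh1 (le_mul_of_one_le_left hh0.le (one_le_pow₀ (by norm_num)))
  have hmono : ∀ i, τ i ≤ τ (i + 1) := by
    rintro (_ | j)
    · exact hτnn 1
    · rw [hτs, hτs]
      refine min_le_min le_rfl ?_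
      rw [pow_succ]
      have : (0:ℝ) < 2 ^ j * h := by positivity
      linarith
  -- For the first jump the right side is h(1+|z|+|z|²). Later the right side is at least the new
  -- depth, which is at most twice the old one.
  have hdist : ∀ i, 2 * ((τ (i + 1) - τ i) * ‖z‖) ≤ 1 - (1 - τ i) * (1 - τ (i + 1)) * ‖z‖ ^ 2 := by
    rintro (_ | j)
    · rw [hτs, hτ0, pow_zero, one_mul, min_eq_right hh1, hh]
      have := norm_nonneg z
      have : 0 ≤ (1 - ‖z‖) * (1 - ‖z‖ + ‖z‖ ^ 2) := mul_nonneg hh0.le (by nlinarith)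
      nlinarith
    · have h2 : τ (j + 1 + 1) ≤ 2 * τ (j + 1) := by
        rw [hτs, hτs, pow_succ]
        rcases le_total 1 (2 ^ j * h) with hc | hc
        · rw [min_eq_left hc]
          exact (min_le_left _ _).trans (by norm_num)
        · rw [min_eq_right hc]
          exact (min_le_right _ _).trans (by linarith)
      have a1 := hτle (j + 1)
      have a2 := hτle (j + 1 + 1)
      have a3 := hmono (j + 1)
      have a4 := hτnn (j + 1)
      have a5 : (1 - τ (j + 1)) * (1 - τ (j + 1 + 1)) * ‖z‖ ^ 2 ≤ 1 * (1 - τ (j + 1 + 1)) * 1 := by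
        have : ‖z‖ ^ 2 ≤ 1 := pow_le_one₀ (norm_nonneg z) hzr.le
        have := sub_nonneg.2 a2
        have := sub_nonneg.2 a1
        gcongr
        linarith
      have a6 : (τ (j + 1 + 1) - τ (j + 1)) * ‖z‖ ≤ τ (j + 1 + 1) - τ (j + 1) :=
        mul_le_of_le_one_right (by linarith) hzr.le
      linarith
  set S : ℝ := (C₁ * ENNReal.ofReal D * I).toReal with hS
  have hSt : C₁ * ENNReal.ofReal D * I ≠ ∞ := by finiteness
  have hS0 : 0 ≤ S := ENNReal.toReal_nonneg
  -- The factor τ^(-θ) at depth about 2^i h gives the decay q^i with q = 2^(-θ); p-th roots then sum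
  -- with ratio ρ = q^(1/p) < 1. Once depth 1 is reached the increments vanish, so the lower bound
  -- on τ is needed only before that.
  have hinc : ∀ i, ‖f (shrink (τ i) z) - f (shrink (τ (i + 1)) z)‖ ^ p ≤ q ^ i * S := by
    intro i
    rcases eq_or_ne (τ i) (τ (i + 1)) with heq | hne
    · rw [heq, sub_self, norm_zero, Real.zero_rpow hp0.ne']
      positivity
    have hτi : τ i < 1 := lt_of_lt_of_le (lt_of_le_of_ne (hmono i) hne) (hτle (i + 1))
    obtain ⟨u, hu, hxu⟩ := exists_mobPhi_shrink_eq hz (hτnn i) (hmono i) (hτle (i + 1)) (hdist i)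
    have hx := shrink_mem (hτnn (i + 1)) (hτle (i + 1)) hz
    have hst := hstep f hfm hf _ hx u hu
    rw [hxu] at hst
    have hlow : 2 ^ i * rho z / 4 ≤ τ (i + 1) := by
      rw [hτs]
      have hi2 : (2:ℝ) ^ i * h ≤ 2 := by
        rcases i with _ | j
        · rw [pow_zero]; linarith
        · rw [hτs] at hτi
          have := (min_lt_iff.1 hτi).resolve_left (lt_irrefl _)
          rw [pow_succ]; linarith
      have : (2:ℝ) ^ i * rho z ≤ 2 * (2 ^ i * h) := by
        have := mul_le_mul_of_nonneg_left hrh (by positivity : (0:ℝ) ≤ 2 ^ i)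
        linarith
      have : (0:ℝ) < 2 ^ i * h := by positivity
      exact le_min (by linarith) (by linarith)
    have hτθ : τ (i + 1) ^ (-θ) ≤ 4 ^ θ * q ^ i * rho z ^ (-θ) := by
      refine (Real.rpow_le_rpow_of_nonpos (by positivity) hlow (by linarith)).trans_eq ?_
      rw [Real.div_rpow (by positivity) (by norm_num), Real.mul_rpow (by positivity) hrz.le,
        Real.rpow_neg (by norm_num : (0:ℝ) ≤ 4), Real.rpow_neg (by positivity : (0:ℝ) ≤ 2 ^ i),
        ← Real.inv_rpow (by positivity), ← inv_pow, ← one_div, hq, ← Real.rpow_natCast,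
        ← Real.rpow_natCast, ← Real.rpow_mul (by norm_num), ← Real.rpow_mul (by norm_num),
        mul_comm θ, div_inv_eq_mul]
      ring
    rw [← ENNReal.ofReal_le_ofReal_iff (by positivity), ENNReal.ofReal_mul (by positivity), hS,
      ENNReal.ofReal_toReal hSt]
    refine hst.trans ?_
    have : ∫⁻ w, ENNReal.ofReal (jac (shrink (τ (i + 1)) z) w ^ A) * oscInv f p m α w ∂(bw n η)
        ≤ ENNReal.ofReal (D * q ^ i) * I := by
      rw [hI, ← mul_assoc, ← ENNReal.ofReal_mul (by positivity),
        ← lintegral_const_mul' _ _ ENNReal.ofReal_ne_top]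
      refine lintegral_bw_mono fun w hw => ?_
      rw [← mul_assoc, ← ENNReal.ofReal_mul (by positivity)]
      refine mul_le_mul_left (ENNReal.ofReal_le_ofReal ?_) _
      have hk := bker_pos hw hz
      calc _ ≤ 4 ^ A * 2 ^ (A - θ) * (τ (i + 1) ^ (-θ) * bker w z ^ (θ - A)) :=
            jac_shrink_rpow_le hz hw (hle i) (hτle (i + 1)) hθ0 hθA
        _ ≤ 4 ^ A * 2 ^ (A - θ) * ((4 ^ θ * q ^ i * rho z ^ (-θ)) * bker w z ^ (θ - A)) := by
            gcongr
        _ = _ := by rw [hD]; ring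
    calc _ ≤ C₁ * (ENNReal.ofReal (D * q ^ i) * I) := by gcongr
      _ = _ := by rw [ENNReal.ofReal_mul hD0.le]; ring
  have hinc' : ∀ i, dist (f (shrink (τ i) z)) (f (shrink (τ (i + 1)) z)) ≤ ρ ^ i * S ^ p⁻¹ := by
    intro i
    rw [dist_eq_norm, hρ, ← Real.rpow_natCast, ← Real.rpow_mul hq0.le, mul_comm p⁻¹,
      Real.rpow_mul hq0.le, Real.rpow_natCast, ← Real.mul_rpow (by positivity) hS0]
    exact (Real.le_rpow_inv_iff_of_pos (norm_nonneg _) (by positivity) hp0).2 (hinc i)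
  obtain ⟨N, hN⟩ := pow_unbounded_of_one_lt (1 / h) (one_lt_two : (1:ℝ) < 2)
  have hτN : τ (N + 1) = 1 := by
    rw [hτs]
    rw [div_lt_iff₀ hh0] at hN
    exact min_eq_left hN.le
  have hsum : ‖f z - f 0‖ ≤ (1 - ρ)⁻¹ * S ^ p⁻¹ := by
    have h1 := dist_le_range_sum_of_dist_le (f := fun i => f (shrink (τ i) z))
      (d := fun i => ρ ^ i * S ^ p⁻¹) (N + 1) fun {i} _ => hinc' i
    simp only [hτN, hτ0, shrink_zero, shrink_one] at h1
    rw [dist_eq_norm, ← Finset.sum_mul] at h1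
    refine h1.trans (mul_le_mul_of_nonneg_right ?_ (by positivity))
    rw [← tsum_geometric_of_lt_one hρ0.le hρ1]
    exact (summable_geometric_of_lt_one hρ0.le hρ1).sum_le_tsum _ fun i _ => by positivity
  have hfin : ‖f z - f 0‖ ^ p ≤ E * S := by
    have := sub_pos.2 hρ1
    refine (Real.rpow_le_rpow (norm_nonneg _) hsum hp0.le).trans_eq ?_
    rw [Real.mul_rpow (by positivity) (by positivity), Real.rpow_inv_rpow hS0 hp0.ne']
  calc _ ≤ ENNReal.ofReal (E * S) := ENNReal.ofReal_le_ofReal hfin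
    _ = ENNReal.ofReal E * (C₁ * ENNReal.ofReal D * I) := by
      rw [ENNReal.ofReal_mul hE0.le, hS, ENNReal.ofReal_toReal hSt]
    _ ≤ ENNReal.ofReal E * ((C₁ * ENNReal.ofReal D + 1) * I) := by
      gcongr
      exact le_self_add
    _ = _ := by ring

/-! ### Kernel operators and measurability of the oscillation -/

lemma measurable_bker : Measurable fun x : EuclideanSpace ℂ (Fin n) × EuclideanSpace ℂ (Fin n) =>
    bker x.1 x.2 := continuous_bker.measurable

lemma measurable_ofReal_bker_rpow (a : EuclideanSpace ℂ (Fin n)) (r : ℝ) :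
    Measurable fun z => ENNReal.ofReal (bker z a ^ r) :=
  ((measurable_bker_left a).pow_const r).ennreal_ofReal

/-- Kernel operators of Forelli-Rudin type are bounded on weighted `L¹` spaces. -/
theorem exists_lintegral_kernel_le (hn : 1 ≤ n) {γ e T r β : ℝ} (h1 : -1 < γ + e)
    (h2 : γ + e + n + 1 < T) (hr0 : 0 ≤ r) (hr : r < γ + e + n + 1) (hβ : β = T - e - n - 1) :
    ∃ C : ℝ≥0∞, C < ∞ ∧ ∀ a ∈ unitBall n, ∀ H : EuclideanSpace ℂ (Fin n) → ℝ≥0∞,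
      AEMeasurable H (bw n β) →
      ∫⁻ z, ENNReal.ofReal (bker z a ^ (-r)) * (ENNReal.ofReal (rho z ^ e) *
        ∫⁻ w, ENNReal.ofReal (bker w z ^ (-T)) * H w ∂(bw n β)) ∂(bw n γ) ≤
      C * ∫⁻ w, ENNReal.ofReal (bker w a ^ (-r)) * H w ∂(bw n γ) := by
  obtain ⟨C, hC, hb⟩ := exists_lintegral_bker_mul_bker_le hn h1 h2 hr0 hr
  refine ⟨C, hC, fun a ha H hH => ?_⟩
  calc _ = ∫⁻ z, ∫⁻ w, ENNReal.ofReal (bker z a ^ (-r)) * ENNReal.ofReal (rho z ^ e) *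
        ENNReal.ofReal (bker w z ^ (-T)) * H w ∂(bw n β) ∂(bw n γ) := by
        refine lintegral_congr fun z => ?_
        rw [← lintegral_const_mul' _ _ ENNReal.ofReal_ne_top,
          ← lintegral_const_mul' _ _ ENNReal.ofReal_ne_top]
        simp only [mul_assoc]
    _ = ∫⁻ w, ∫⁻ z, ENNReal.ofReal (bker z a ^ (-r)) * ENNReal.ofReal (rho z ^ e) *
        ENNReal.ofReal (bker w z ^ (-T)) * H w ∂(bw n γ) ∂(bw n β) := by
        refine lintegral_lintegral_swap ?_
        have hk : Measurable fun x : EuclideanSpace ℂ (Fin n) × EuclideanSpace ℂ (Fin n) =>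
            ENNReal.ofReal (bker x.1 a ^ (-r)) * ENNReal.ofReal (rho x.1 ^ e) *
              ENNReal.ofReal (bker x.2 x.1 ^ (-T)) :=
          (((measurable_ofReal_bker_rpow a (-r)).comp measurable_fst).mul
            ((measurable_ofReal_rho_rpow e).comp measurable_fst)).mul
            ((measurable_bker.comp measurable_swap).pow_const (-T)).ennreal_ofReal
        exact hk.aemeasurable.mul hH.comp_snd
    _ ≤ ∫⁻ w, C * (ENNReal.ofReal (rho w ^ (γ - β)) *
          (ENNReal.ofReal (bker w a ^ (-r)) * H w)) ∂(bw n β) := by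
        refine lintegral_bw_mono fun w hw => ?_
        have hrw := rho_pos hw
        calc _ = (∫⁻ z, ENNReal.ofReal (bker z w ^ (-T) * bker z a ^ (-r)) ∂(bw n (γ + e))) * H w := by
              rw [lintegral_bw_add, ← lintegral_mul_const _ (by
                refine (measurable_ofReal_rho_rpow e).mul (Measurable.ennreal_ofReal ?_)
                exact ((measurable_bker_left w).pow_const _).mul
                  ((measurable_bker_left a).pow_const _))]
              refine lintegral_bw_congr fun z hz => ?_
              have := bker_pos hz hw
              rw [ENNReal.ofReal_mul (by positivity), bker_comm w z]
              ring
          _ ≤ (C * ENNReal.ofReal (rho w ^ (γ + e + n + 1 - T) * bker w a ^ (-r))) * H w := by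
              gcongr
              exact hb w hw a ha
          _ = _ := by
              -- The value of β is forced by homogeneity: the power of `rho w` left by the two-point
              -- estimate must turn the weight β into γ.
              have : γ + e + n + 1 - T = γ - β := by rw [hβ]; ring
              rw [this, ENNReal.ofReal_mul (by positivity)]
              ring
    _ = _ := by
        rw [lintegral_const_mul' _ _ hC.ne, ← lintegral_bw_add]
        congr 2
        rw [add_sub_cancel]

/-- The projection in `mobNum w z` depends on w, which obscures joint measurability; on the ball its
norm equals this square root, visibly measurable in both variables. -/
lemma measurable_norm_mobNum_aux (p κ : ℝ) {f : EuclideanSpace ℂ (Fin n) → ℂ} (hfm : Measurable f) :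
    Measurable fun x : EuclideanSpace ℂ (Fin n) × EuclideanSpace ℂ (Fin n) =>
      ENNReal.ofReal (‖f x.1 - f x.2‖ ^ p /
        Real.sqrt (bker x.1 x.2 ^ 2 - rho x.2 * rho x.1) ^ κ) := by
  refine Measurable.ennreal_ofReal (Measurable.div ?_ ?_)
  · exact (((hfm.comp measurable_fst).sub (hfm.comp measurable_snd)).norm).pow_const p
  · refine (Measurable.sqrt ?_).pow_const κ
    exact (measurable_bker.pow_const 2).sub
      ((measurable_rho.comp measurable_snd).mul (measurable_rho.comp measurable_fst))

lemma aemeasurable_oscInt (p κ α η : ℝ) {f : EuclideanSpace ℂ (Fin n) → ℂ} (hfm : Measurable f) :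
    AEMeasurable (oscInt f p κ α) (bw n η) := by
  refine ⟨_, (measurable_norm_mobNum_aux p κ hfm).lintegral_prod_right' (ν := bw n α), ?_⟩
  refine (ae_bw η).mono fun z hz => ?_
  rw [oscInt]
  refine lintegral_bw_congr fun w hw => ?_
  rw [← norm_mobNum_sq hw, Real.sqrt_sq (norm_nonneg _)]

lemma aemeasurable_oscInv (p m α η : ℝ) {f : EuclideanSpace ℂ (Fin n) → ℂ} (hfm : Measurable f) :
    AEMeasurable (oscInv f p m α) (bw n η) :=
  (measurable_ofReal_rho_rpow m).aemeasurable.mul (aemeasurable_oscInt p (2 * m) α η hfm)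

/-! ### The two norm inequalities -/

lemma jac_rpow_eq {a z : EuclideanSpace ℂ (Fin n)} (ha : a ∈ unitBall n) (hz : z ∈ unitBall n)
    (σ : ℝ) : jac a z ^ σ = rho a ^ σ * bker z a ^ (-(2 * σ)) := by
  have hk := bker_pos hz ha
  unfold jac
  rw [Real.div_rpow (rho_pos ha).le (by positivity), Real.rpow_neg hk.le, Real.rpow_mul hk.le,
    Real.rpow_two, div_eq_mul_inv]

/-- The kernel operator here has e = m, T = 2m and r = 2σ, for which the conditions T > γ+e+n+1 and
r < γ+e+n+1 read q+σ < m and σ < q+m. -/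
theorem exists_lintegral_oscInv_le (hn : 1 ≤ n) {p m α q σ γ : ℝ} (hα : -1 < α) (hp : 1 ≤ p)
    (hm : m = α + n + 1) (hmp : 2 * m ≤ p) (hq : 0 < q) (hσ : 0 ≤ σ) (hγ : γ = q + σ - n - 1)
    (hγ1 : -1 < γ) (hmq : q + σ < m) :
    ∃ C : ℝ≥0∞, C < ∞ ∧
      ∀ f : EuclideanSpace ℂ (Fin n) → ℂ, Measurable f → DifferentiableOn ℂ f (unitBall n) →
      ∀ a ∈ unitBall n,
        ∫⁻ z, ENNReal.ofReal (jac a z ^ σ) * oscInv f p m α z ∂(bw n γ) ≤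
          C * ∫⁻ z, ENNReal.ofReal (jac a z ^ σ) * ENNReal.ofReal (‖f z‖ ^ p) ∂(bw n γ) := by
  obtain ⟨C₁, hC₁, h1⟩ := exists_oscInt_le hn hα hm hp hmp
  obtain ⟨C₂, hC₂, h2⟩ := exists_lintegral_kernel_le hn (γ := γ) (e := m) (T := 2 * m)
    (r := 2 * σ) (β := α) (by linarith) (by linarith) (by linarith) (by linarith) (by linarith)
  refine ⟨C₁ * C₂, ENNReal.mul_lt_top hC₁ hC₂, fun f hfm hf a ha => ?_⟩
  have hra := rho_pos ha
  have e : ∀ H : EuclideanSpace ℂ (Fin n) → ℝ≥0∞,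
      ∫⁻ z, ENNReal.ofReal (jac a z ^ σ) * H z ∂(bw n γ) = ENNReal.ofReal (rho a ^ σ) *
        ∫⁻ z, ENNReal.ofReal (bker z a ^ (-(2 * σ))) * H z ∂(bw n γ) := by
    intro H
    rw [← lintegral_const_mul' _ _ ENNReal.ofReal_ne_top]
    refine lintegral_bw_congr fun z hz => ?_
    rw [jac_rpow_eq ha hz, ENNReal.ofReal_mul (by positivity), mul_assoc]
  have h3 := h2 a ha _ (measurable_ofReal_norm_rpow hfm p).aemeasurable
  rw [e, e]
  calc _ ≤ ENNReal.ofReal (rho a ^ σ) * (C₁ * ∫⁻ z, ENNReal.ofReal (bker z a ^ (-(2 * σ))) *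
          (ENNReal.ofReal (rho z ^ m) * ∫⁻ w, ENNReal.ofReal (bker w z ^ (-(2 * m))) *
            ENNReal.ofReal (‖f w‖ ^ p) ∂(bw n α)) ∂(bw n γ)) := by
        gcongr
        rw [← lintegral_const_mul' _ _ hC₁.ne]
        refine lintegral_bw_mono fun z hz => ?_
        rw [mul_left_comm C₁, mul_left_comm C₁, oscInv]
        gcongr
        refine (h1 f hfm hf z hz).trans_eq ?_
        congr 1
        refine lintegral_congr fun w => ?_
        rw [ENNReal.ofReal_mul (by positivity), mul_comm]
    _ ≤ ENNReal.ofReal (rho a ^ σ) * (C₁ * (C₂ * ∫⁻ w, ENNReal.ofReal (bker w a ^ (-(2 * σ))) *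
          ENNReal.ofReal (‖f w‖ ^ p) ∂(bw n γ))) := by gcongr
    _ = _ := by ring

/-- Split f into f - f(0) and f(0). The first part goes through the radial growth bound, the kernel
operator and the Carleson comparison; the second needs only the one-point estimate. -/
theorem exists_lintegral_norm_rpow_le (hn : 1 ≤ n) {p m α q σ γ : ℝ} (hα : -1 < α) (hp : 1 ≤ p)
    (hm : m = α + n + 1) (hq : 0 < q) (hσ : 0 < σ) (hγ : γ = q + σ - n - 1) (hγ1 : -1 < γ) :
    ∃ C : ℝ≥0∞, C < ∞ ∧
      ∀ f : EuclideanSpace ℂ (Fin n) → ℂ, Measurable f → DifferentiableOn ℂ f (unitBall n) →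
      ∀ M : ℝ≥0∞, (∀ a ∈ unitBall n,
        ∫⁻ z, ENNReal.ofReal (jac a z ^ σ) * oscInv f p m α z ∂(bw n γ) ≤ M) →
      ∀ a ∈ unitBall n,
        ∫⁻ z, ENNReal.ofReal (jac a z ^ σ) * ENNReal.ofReal (‖f z‖ ^ p) ∂(bw n γ) ≤
          C * (ENNReal.ofReal (‖f 0‖ ^ p) + M) := by
  -- The kernel operator requires t+σ < γ-θ+n+1 = q+σ-θ and γ-θ > -1; t ≤ q/2, θ ≤ q/4 and θ ≤
  -- (γ+1)/2 secure both. The bound t ≤ σ is for the comparison with `jac`, and A > q+σ gives T >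
  -- γ-θ+n+1.
  set t := min σ (q / 2) with ht
  have ht0 : 0 < t := lt_min hσ (by linarith)
  have htσ : t ≤ σ := min_le_left _ _
  have htq : t ≤ q / 2 := min_le_right _ _
  set θ := min (q / 4) ((γ + 1) / 2) with hθ
  have hθ0 : 0 < θ := lt_min (by linarith) (by linarith)
  have hθq : θ ≤ q / 4 := min_le_left _ _
  have hθγ : θ ≤ (γ + 1) / 2 := min_le_right _ _
  set A := q + σ + 1 with hA
  set η := A - n - 1 with hη
  obtain ⟨C₀, hC₀, h0⟩ := exists_lintegral_bker_le (δ := γ) (c := t + σ) hn hγ1 (by linarith)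
  obtain ⟨C₃, hC₃, h3⟩ := exists_norm_sub_zero_rpow_le hn hα hp hm (η := η) (A := A) (θ := θ)
    (by linarith) (by linarith) hθ0 (by linarith)
  obtain ⟨C₄, hC₄, h4⟩ := exists_lintegral_kernel_le hn (γ := γ) (e := -θ) (T := A - θ)
    (r := t + σ) (β := η) (by linarith) (by linarith) (by linarith) (by linarith) (by linarith)
  obtain ⟨C₅, hC₅, h5⟩ := exists_lintegral_carleson_le (n := n) hσ.le ht0
  refine ⟨ENNReal.ofReal (2 ^ (σ - t)) * ENNReal.ofReal (2 ^ p) * (C₀ + C₃ * C₄ * C₅),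
    by finiteness, fun f hfm hf M hM a ha => ?_⟩
  have hra := rho_pos ha
  have hJ := fun β => aemeasurable_oscInv (n := n) p m α β hfm
  have hker : Measurable fun z => ENNReal.ofReal (rho a ^ t * bker z a ^ (-(t + σ))) :=
    (((measurable_bker_left a).pow_const _).const_mul _).ennreal_ofReal
  -- The hypothesis on M is a Carleson condition for the measure with density `oscInv f` relative to
  -- `bw n γ`; the comparison of scales lowers the kernel exponent from 2σ to t+σ.
  have hcar : ∫⁻ w, ENNReal.ofReal (rho a ^ t * bker w a ^ (-(t + σ))) * oscInv f p m α w ∂(bw n γ)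
      ≤ C₅ * M := by
    have h := h5 ((bw n γ).withDensity (oscInv f p m α)) M
      ((withDensity_absolutelyContinuous _ _).ae_le (ae_bw γ)) (fun b hb => by
        rw [lintegral_withDensity_eq_lintegral_mul₀ (hJ γ)
          (measurable_ofReal_jac b σ).aemeasurable]
        refine le_trans (le_of_eq ?_) (hM b hb)
        exact lintegral_congr fun z => mul_comm _ _) a ha
    rw [lintegral_withDensity_eq_lintegral_mul₀ (hJ γ) hker.aemeasurable] at h
    refine le_trans (le_of_eq ?_) h
    exact lintegral_congr fun z => mul_comm _ _
  have hosc : ∫⁻ z, ENNReal.ofReal (rho a ^ t * bker z a ^ (-(t + σ))) *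
      ENNReal.ofReal (‖f z - f 0‖ ^ p) ∂(bw n γ) ≤ C₃ * C₄ * C₅ * M := by
    calc _ ≤ ∫⁻ z, (ENNReal.ofReal (rho a ^ t) * C₃) * (ENNReal.ofReal (bker z a ^ (-(t + σ))) *
            (ENNReal.ofReal (rho z ^ (-θ)) * ∫⁻ w, ENNReal.ofReal (bker w z ^ (-(A - θ))) *
              oscInv f p m α w ∂(bw n η))) ∂(bw n γ) := by
          refine lintegral_bw_mono fun z hz => ?_
          have h := h3 f hfm hf z hz
          rw [← neg_sub A θ] at h
          rw [ENNReal.ofReal_mul (by positivity)]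
          refine (mul_le_mul_right h _).trans_eq ?_
          ring
      _ = (ENNReal.ofReal (rho a ^ t) * C₃) * ∫⁻ z, (ENNReal.ofReal (bker z a ^ (-(t + σ))) *
            (ENNReal.ofReal (rho z ^ (-θ)) * ∫⁻ w, ENNReal.ofReal (bker w z ^ (-(A - θ))) *
              oscInv f p m α w ∂(bw n η))) ∂(bw n γ) := lintegral_const_mul' _ _ (by finiteness)
      _ ≤ (ENNReal.ofReal (rho a ^ t) * C₃) * (C₄ * ∫⁻ w, ENNReal.ofReal (bker w a ^ (-(t + σ))) *
            oscInv f p m α w ∂(bw n γ)) := by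
          gcongr
          exact h4 a ha _ (hJ η)
      _ = C₃ * C₄ * ∫⁻ w, ENNReal.ofReal (rho a ^ t * bker w a ^ (-(t + σ))) *
            oscInv f p m α w ∂(bw n γ) := by
          simp only [ENNReal.ofReal_mul (Real.rpow_nonneg hra.le t), mul_assoc]
          rw [lintegral_const_mul' _ _ ENNReal.ofReal_ne_top]
          ring
      _ ≤ C₃ * C₄ * (C₅ * M) := by gcongr
      _ = _ := by ring
  have hconst : ∫⁻ z, ENNReal.ofReal (rho a ^ t * bker z a ^ (-(t + σ))) *
      ENNReal.ofReal (‖f 0‖ ^ p) ∂(bw n γ) ≤ C₀ * ENNReal.ofReal (‖f 0‖ ^ p) := by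
    rw [lintegral_mul_const _ hker]
    gcongr
    refine le_trans (lintegral_bw_mono fun z hz => ENNReal.ofReal_le_ofReal ?_) (h0 a ha)
    have := bker_pos hz ha
    exact mul_le_of_le_one_left (by positivity) (Real.rpow_le_one hra.le (rho_le_one a) ht0.le)
  have hjac : ∀ z ∈ unitBall n, jac a z ^ σ ≤
      2 ^ (σ - t) * (rho a ^ t * bker z a ^ (-(t + σ))) := by
    intro z hz
    have hk := bker_pos hz ha
    have h1 : (rho a / bker z a) ^ (σ - t) ≤ 2 ^ (σ - t) :=
      Real.rpow_le_rpow (by positivity) ((div_le_iff₀ hk).2 (rho_le_two_bker hz ha)) (by linarith)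
    have h2 : jac a z ^ σ = (rho a / bker z a) ^ (σ - t) * (rho a ^ t * bker z a ^ (-(t + σ))) := by
      unfold jac
      obtain ⟨x1, hx1⟩ := exists_exp_eq hra
      obtain ⟨x2, hx2⟩ := exists_exp_eq hk
      simp only [← hx1, ← hx2, ← Real.exp_nat_mul, ← Real.exp_sub, ← Real.exp_add, ← Real.exp_mul]
      congr 1; push_cast; ring
    rw [h2]
    gcongr
  calc _ ≤ ∫⁻ z, (ENNReal.ofReal (2 ^ (σ - t)) * ENNReal.ofReal (2 ^ p)) *
        (ENNReal.ofReal (rho a ^ t * bker z a ^ (-(t + σ))) * ENNReal.ofReal (‖f z - f 0‖ ^ p) +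
        ENNReal.ofReal (rho a ^ t * bker z a ^ (-(t + σ))) * ENNReal.ofReal (‖f 0‖ ^ p))
        ∂(bw n γ) := by
        refine lintegral_bw_mono fun z hz => ?_
        have hk := bker_pos hz ha
        have hs := add_rpow_le_two_rpow (norm_nonneg (f z - f 0)) (norm_nonneg (f 0))
          (by linarith : 0 ≤ p)
        have hn : ‖f z‖ ^ p ≤ (‖f z - f 0‖ + ‖f 0‖) ^ p := by
          refine Real.rpow_le_rpow (norm_nonneg _) ?_ (by linarith)
          simpa using norm_add_le (f z - f 0) (f 0)
        rw [← mul_add, ← ENNReal.ofReal_add (by positivity) (by positivity)]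
        calc _ ≤ ENNReal.ofReal (2 ^ (σ - t) * (rho a ^ t * bker z a ^ (-(t + σ)))) *
              ENNReal.ofReal (2 ^ p * (‖f z - f 0‖ ^ p + ‖f 0‖ ^ p)) := by
              gcongr
              · exact hjac z hz
              · exact hn.trans hs
          _ = _ := by
              rw [ENNReal.ofReal_mul (by positivity), ENNReal.ofReal_mul (p := 2 ^ p)
                (by positivity)]
              ring
    _ = (ENNReal.ofReal (2 ^ (σ - t)) * ENNReal.ofReal (2 ^ p)) *
        (∫⁻ z, ENNReal.ofReal (rho a ^ t * bker z a ^ (-(t + σ))) *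
          ENNReal.ofReal (‖f z - f 0‖ ^ p) ∂(bw n γ) +
        ∫⁻ z, ENNReal.ofReal (rho a ^ t * bker z a ^ (-(t + σ))) *
          ENNReal.ofReal (‖f 0‖ ^ p) ∂(bw n γ)) := by
        rw [lintegral_const_mul' _ _ (by finiteness), lintegral_add_right _ (hker.mul_const _)]
    _ ≤ (ENNReal.ofReal (2 ^ (σ - t)) * ENNReal.ofReal (2 ^ p)) *
        (C₃ * C₄ * C₅ * M + C₀ * ENNReal.ofReal (‖f 0‖ ^ p)) := by gcongr
    _ ≤ (ENNReal.ofReal (2 ^ (σ - t)) * ENNReal.ofReal (2 ^ p)) *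
        ((C₀ + C₃ * C₄ * C₅) * (ENNReal.ofReal (‖f 0‖ ^ p) + M)) := by
        gcongr
        have : (C₀ + C₃ * C₄ * C₅) * (ENNReal.ofReal (‖f 0‖ ^ p) + M) =
          (C₃ * C₄ * C₅ * M + C₀ * ENNReal.ofReal (‖f 0‖ ^ p)) +
          (C₀ * M + C₃ * C₄ * C₅ * ENNReal.ofReal (‖f 0‖ ^ p)) := by ring
        rw [this]
        exact le_self_add
    _ = _ := by ring

/-! ### Normalizations and the theorem -/

lemma volume_unitBall_ne_zero : volume (unitBall n) ≠ 0 :=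
  (measure_ball_pos volume (0 : EuclideanSpace ℂ (Fin n)) one_pos).ne'

lemma volume_unitBall_ne_top : volume (unitBall n) ≠ ∞ :=
  (measure_ball_lt_top (x := (0 : EuclideanSpace ℂ (Fin n)))).ne

lemma ballInv_eq (n : ℕ) : ballInv n = (volume (unitBall n))⁻¹ • bw n (-(n : ℝ) - 1) := by
  rw [ballInv, ballVol, withDensity_smul_measure]
  rfl

lemma ballVolW_eq (n : ℕ) {α : ℝ} (hα : -1 < α) :
    ballVolW n α = ((volume (unitBall n))⁻¹ * ENNReal.ofReal
      (Real.Gamma (n + α + 1) / (n.factorial * Real.Gamma (α + 1)))) • bw n α := by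
  have hn : (0:ℝ) ≤ n := by positivity
  have h1 := Real.Gamma_pos_of_pos (by linarith : 0 < n + α + 1)
  have h2 := Real.Gamma_pos_of_pos (by linarith : 0 < α + 1)
  rw [ballVolW, ballVol, withDensity_smul_measure, mul_smul, bw, ← withDensity_smul _
    (measurable_ofReal_rho_rpow α)]
  congr 2
  ext z
  rw [ENNReal.ofReal_mul (by positivity)]
  rfl

lemma iSup_mem_lt_top_iff {X : Type*} {B : Set X} {F G : X → ℝ≥0∞} {c : ℝ≥0∞} (h0 : c ≠ 0)
    (ht : c ≠ ∞) (h : ∀ a ∈ B, F a = c * G a) :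
    ⨆ a ∈ B, F a < ∞ ↔ ∃ M < ∞, ∀ a ∈ B, G a ≤ M := by
  constructor
  · intro hF
    refine ⟨c⁻¹ * ⨆ a ∈ B, F a, ENNReal.mul_lt_top (ENNReal.inv_lt_top.2 h0.bot_lt) hF,
      fun a ha => ?_⟩
    have h1 : F a ≤ ⨆ a ∈ B, F a := le_iSup₂ (f := fun a (_ : a ∈ B) => F a) a ha
    calc G a = c⁻¹ * F a := by rw [h a ha, ← mul_assoc, ENNReal.inv_mul_cancel h0 ht, one_mul]
      _ ≤ _ := by gcongr
  · rintro ⟨M, hM, hG⟩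
    refine lt_of_le_of_lt (iSup₂_le (a := c * M) fun a ha => ?_) (ENNReal.mul_lt_top ht.lt_top hM)
    rw [h a ha]
    gcongr
    exact hG a ha

lemma one_sub_norm_mobPhi_rpow {a z : EuclideanSpace ℂ (Fin n)} (ha : a ∈ unitBall n)
    (hz : z ∈ unitBall n) (σ : ℝ) :
    (1 - ‖mobPhi a z‖ ^ 2) ^ σ = jac a z ^ σ * rho z ^ σ := by
  change rho (mobPhi a z) ^ σ = _
  rw [rho_mobPhi ha hz, ← Real.mul_rpow (jac_pos ha hz).le (rho_pos hz).le, jac]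
  congr 1; ring

lemma lintegral_ballInv_eq {p q σ γ : ℝ} (hγ : γ = q + σ - n - 1)
    {f g : EuclideanSpace ℂ (Fin n) → ℂ} (hfg : ∀ z ∈ unitBall n, f z = g z)
    {a : EuclideanSpace ℂ (Fin n)} (ha : a ∈ unitBall n) :
    ∫⁻ z, ENNReal.ofReal (‖f z‖ ^ p * (1 - ‖z‖ ^ 2) ^ q * (1 - ‖mobPhi a z‖ ^ 2) ^ σ) ∂(ballInv n)
      = (volume (unitBall n))⁻¹ *
        ∫⁻ z, ENNReal.ofReal (jac a z ^ σ) * ENNReal.ofReal (‖g z‖ ^ p) ∂(bw n γ) := by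
  have e : γ = (-(n : ℝ) - 1) + (q + σ) := by rw [hγ]; ring
  rw [ballInv_eq, lintegral_smul_measure, smul_eq_mul, e, lintegral_bw_add]
  congr 1
  refine lintegral_bw_congr fun z hz => ?_
  have hr := rho_pos hz
  have hj := jac_pos ha hz
  rw [one_sub_norm_mobPhi_rpow ha hz, hfg z hz, ← ENNReal.ofReal_mul (by positivity),
    ← ENNReal.ofReal_mul (by positivity), Real.rpow_add hr]
  congr 1
  unfold rho
  ring

lemma oscInt_congr {f g : EuclideanSpace ℂ (Fin n) → ℂ} (hfg : ∀ z ∈ unitBall n, f z = g z)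
    (p κ α : ℝ) {z : EuclideanSpace ℂ (Fin n)} (hz : z ∈ unitBall n) :
    oscInt f p κ α z = oscInt g p κ α z :=
  lintegral_bw_congr fun w hw => by rw [hfg z hz, hfg w hw]

lemma lintegral_ballVolW_eq {p q σ γ α m : ℝ} (hα : -1 < α) (hm : m = α + n + 1)
    (hγ : γ = q + σ - n - 1)
    {f g : EuclideanSpace ℂ (Fin n) → ℂ} (hfg : ∀ z ∈ unitBall n, f z = g z)
    {a : EuclideanSpace ℂ (Fin n)} (ha : a ∈ unitBall n) :
    ∫⁻ z, ∫⁻ w, ENNReal.ofReal (‖f z - f w‖ ^ p / ‖mobNum w z‖ ^ (2 * m)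
          * (1 - ‖z‖ ^ 2) ^ q * (1 - ‖mobPhi a z‖ ^ 2) ^ σ) ∂(ballVolW n α) ∂(ballVolW n α)
      = ((volume (unitBall n))⁻¹ * ENNReal.ofReal
          (Real.Gamma (n + α + 1) / (n.factorial * Real.Gamma (α + 1)))) ^ 2 *
        ∫⁻ z, ENNReal.ofReal (jac a z ^ σ) * oscInv g p m α z ∂(bw n γ) := by
  have e : γ = α + (q + σ - m) := by rw [hγ, hm]; ring
  have hb := ballVolW_eq n hα
  set c := (volume (unitBall n))⁻¹ * ENNReal.ofReal
    (Real.Gamma (n + α + 1) / (n.factorial * Real.Gamma (α + 1)))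
  have hc : c ≠ ∞ := ENNReal.mul_ne_top
    (ENNReal.inv_ne_top.2 volume_unitBall_ne_zero) ENNReal.ofReal_ne_top
  rw [hb, lintegral_smul_measure, smul_eq_mul, sq, mul_assoc c c, e, lintegral_bw_add]
  congr 1
  rw [← lintegral_const_mul' _ _ hc]
  refine lintegral_bw_congr fun z hz => ?_
  have hr := rho_pos hz
  have hj := jac_pos ha hz
  rw [lintegral_smul_measure, smul_eq_mul, oscInv, ← oscInt_congr hfg p (2 * m) α hz, oscInt,
    ← mul_assoc (ENNReal.ofReal (jac a z ^ σ)), ← mul_assoc (ENNReal.ofReal (rho z ^ (q + σ - m))),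
    ← ENNReal.ofReal_mul (by positivity), ← ENNReal.ofReal_mul (by positivity),
    ← lintegral_const_mul' _ _ ENNReal.ofReal_ne_top]
  congr 1
  refine lintegral_congr fun w => ?_
  rw [← ENNReal.ofReal_mul (by positivity), one_sub_norm_mobPhi_rpow ha hz]
  congr 1
  -- The power m built into `oscInv` compensates the passage from weight α to γ = α+q+σ-m.
  have h1 : rho z ^ (q + σ - m) * (jac a z ^ σ * rho z ^ m) = rho z ^ q * (jac a z ^ σ * rho z ^ σ) := by
    have : q + σ - m = q + σ + -m := by ring
    rw [this, Real.rpow_add hr, Real.rpow_add hr, Real.rpow_neg hr.le]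
    have : rho z ^ m ≠ 0 := by positivity
    field_simp
  rw [h1]
  unfold rho
  ring

end

theorem theorem3p2 (n : ℕ) (hn : 1 ≤ n) (p q s α : ℝ) (hq : 0 < q)
    (hs : max 0 (1 - q / n) < s) (hα : q + n * s - n - 1 < α) (hp : 2 * (n + 1 + α) ≤ p)
    (f : EuclideanSpace ℂ (Fin n) → ℂ) (hf : DifferentiableOn ℂ f (unitBall n)) :
    (f ∈ NSpace n p q s ↔
      ⨆ a ∈ unitBall n, ∫⁻ z, ∫⁻ w, ENNReal.ofReal
        (‖f z - f w‖ ^ p / ‖mobNum w z‖ ^ (2 * (n + 1 + α))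
          * (1 - ‖z‖ ^ 2) ^ q * (1 - ‖mobPhi a z‖ ^ 2) ^ (n * s))
        ∂(ballVolW n α) ∂(ballVolW n α) < ∞) ∧
    ∀ z ∈ unitBall n, ∀ w ∈ unitBall n,
      ‖mobNum w z‖ = ‖mobPhi z w‖ * ‖1 - herm z w‖ := by
  refine ⟨?_, fun z hz w hw => norm_mobNum_eq_mobPhi hz hw⟩
  have hn1 : (1:ℝ) ≤ n := by exact_mod_cast hn
  have hn0 : (0:ℝ) < n := by linarith
  have hs0 : 0 < s := (le_max_left _ _).trans_lt hs
  have hσ0 : 0 < n * s := by positivity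
  -- This is γ > -1, the only use of s > 1 - q/n.
  have hqσ : (n : ℝ) < q + n * s := by
    have h := (le_max_right 0 (1 - q / n)).trans_lt hs
    have h2 : n * (1 - q / n) < n * s := mul_lt_mul_of_pos_left h hn0
    have h3 : n * (1 - q / n) = n - q := by field_simp
    linarith
  have hα1 : -1 < α := by linarith
  have hp1 : 1 ≤ p := by linarith
  classical
  -- Cutting f off outside the ball makes it measurable everywhere without changing any of the
  -- integrals.
  set g := (unitBall n).indicator f with hg
  have hfg : ∀ z ∈ unitBall n, f z = g z := fun z hz => (Set.indicator_of_mem hz f).symm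
  have hgd : DifferentiableOn ℂ g (unitBall n) := hf.congr fun z hz => (hfg z hz).symm
  have hgm : Measurable g := by
    have := (hf.continuousOn.measurable_piecewise (g := (0 : EuclideanSpace ℂ (Fin n) → ℂ)) continuousOn_const
      measurableSet_unitBall)
    rwa [Set.piecewise_eq_indicator] at this
  have hm : (n : ℝ) + 1 + α = α + n + 1 := by ring
  have hG : 0 < Real.Gamma (n + α + 1) / (n.factorial * Real.Gamma (α + 1)) := by
    have h1 := Real.Gamma_pos_of_pos (by linarith : 0 < n + α + 1)
    have h2 := Real.Gamma_pos_of_pos (by linarith : 0 < α + 1)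
    positivity
  have hv0 : (volume (unitBall n))⁻¹ ≠ 0 := ENNReal.inv_ne_zero.2 volume_unitBall_ne_top
  have hvt : (volume (unitBall n))⁻¹ ≠ ∞ := ENNReal.inv_ne_top.2 volume_unitBall_ne_zero
  have hN := iSup_mem_lt_top_iff hv0 hvt fun a ha =>
    lintegral_ballInv_eq (p := p) (q := q) (σ := n * s) rfl hfg ha
  have hI := iSup_mem_lt_top_iff
    (pow_ne_zero 2 (mul_ne_zero hv0 (ENNReal.ofReal_pos.2 hG).ne'))
    (ENNReal.pow_ne_top (ENNReal.mul_ne_top hvt ENNReal.ofReal_ne_top)) fun a ha =>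
    lintegral_ballVolW_eq (p := p) (q := q) (σ := n * s) hα1 hm rfl hfg ha
  rw [hI]
  have hmem : f ∈ NSpace n p q s ↔ ⨆ a ∈ unitBall n, ∫⁻ z, ENNReal.ofReal
      (‖f z‖ ^ p * (1 - ‖z‖ ^ 2) ^ q * (1 - ‖mobPhi a z‖ ^ 2) ^ (n * s)) ∂(ballInv n) < ∞ :=
    and_iff_right hf
  rw [hmem, hN]
  constructor
  · rintro ⟨M, hM, h⟩
    obtain ⟨C, hC, hC'⟩ := exists_lintegral_oscInv_le hn (q := q) (σ := n * s) hα1 hp1 hm hp hq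
      hσ0.le rfl (by linarith) (by linarith)
    refine ⟨C * M, ENNReal.mul_lt_top hC hM, fun a ha => (hC' g hgm hgd a ha).trans ?_⟩
    gcongr
    exact h a ha
  · rintro ⟨M, hM, h⟩
    obtain ⟨C, hC, hC'⟩ := exists_lintegral_norm_rpow_le hn (q := q) (σ := n * s) hα1 hp1 hm hq
      hσ0 rfl (by linarith)
    exact ⟨_, ENNReal.mul_lt_top hC (ENNReal.add_lt_top.2 ⟨ENNReal.ofReal_lt_top, hM⟩),
      hC' g hgm hgd M h⟩
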